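/- **Setting.** Let $k\ge 1$, $m\ge 2k$, $\sigma>0$, $\phi(t)=e^{-t^2/\sigma^2}$, sample locations $s_1,\dots,s_m\in\mathbb R$, source locations $t_1^*,\dots,t_k^*\in\mathbb R$ and weights $a_1,\dots,a_k>0$ with $\sum_i a_i\le\Pi$. For $\lambda\in\mathbb R^m$ put $q_\lambda(t)=\sum_{j=1}^m\lambda_j\phi(t-s_j)$. Let $\lambda^*\in\mathbb R^m$ satisfy $\|\lambda^*\|_\infty\le\tau$ and suppose that its dual certificate $q=q_{\lambda^*}$ has at every $t_p^*$ a local maximum with $q(t_p^*)=1$ and $q''(t_p^*)\ne0$ (as for a dual solution with non-degenerate certificate). **Constants.** Let $c=4\sqrt{9-3\sqrt6}\,e^{-(3-\sqrt6)/2}$, $c_2=4+c\sqrt2/\sqrt e$ and, for $p=1,\dots,k$, $$\delta_{0,p}=\frac{\sigma^2|q''(t_p^*)|}{\sqrt m\,(4+2c\|\lambda^*\|_2/\sigma)},\qquad \delta_\lambda=\min_p\frac{\sigma\sqrt e\,|q''(t_p^*)|}{2\sqrt{2m}}\,\delta_{0,p},$$ $$C_{t^*}=\max_p\left[\frac{2\sqrt{2m}\,(2\sigma+c\|\lambda^*\|_2)}{|q''(t_p^*)|\,\sigma\sqrt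 e\,(4\sigma+c\|\lambda^*\|_2)}+\frac{2\sigma}{4\sigma+c\|\lambda^*\|_2}\right].$$ Let $t_p(\lambda)$ be the critical point of $q_\lambda$ in $[t_p^*-\delta_{0,p},\,t_p^*+\delta_{0,p}]$ (set $t_p(\lambda)=t_p^*$ if there is none). Let $$\bar\Delta_2=\sup_{p,\lambda,\lambda_\delta}\frac{\bigl(c_2C_{t^*}\sqrt m\,\|\lambda_\delta\|_2+\tfrac{2\sqrt2}{\sqrt e}\sigma\bigr)\sqrt k}{\bigl(\sigma^2\,|q''(t_p(\lambda_\delta))|-2\sqrt m\,\|\lambda-\lambda^*\|_2\bigr)^2},$$ the supremum being over $p\in\{1,\dots,k\}$, over $\lambda\in\mathbb R^m$ with $\|\lambda-\lambda^*\|_2\le\delta_\lambda$ that differ from $\lambda^*$ only in the first $k$ entries, and over $\lambda_\delta$ on the segment from $\lambda^*$ to $\lambda$. Finally $$P=\sqrt2\,k\Bigl[\tfrac1{\sigma^2}\bigl(2\sqrt k\,C_{t^*}^2\Pi+4kC_{t^*}\bar\Delta_2\tau\Pi+2C_{t^*}\bigr)+\tfrac1\sigma\Bigl(\tfrac{\sqrt{2k}\,C_{t^*}}{\sqrt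 e}+4\sqrt k\,C_{t^*}^2\Pi+\tfrac{2\sqrt2\,\bar\Delta_2\Pi}{\sqrt e}+8kC_{t^*}\bar\Delta_2\tau\Pi+\tfrac{\sqrt{2k}\,\bar\Delta_2\Pi}{\sqrt e}\Bigr)\Bigr].$$ **The map.** For $\gamma=(\lambda,\nu)\in\mathbb R^k\times\mathbb R^k$ and $w\in\mathbb R^{2k}$ let $F(\gamma,w)\in\mathbb R^{2k}$ have the entries $$F_j(\gamma,w)=\sum_{i=1}^k a_i\phi(t_i^*-s_j)+w_j-\sum_{i=1}^k\nu_i\,\phi(t_i(\lambda)-s_j),\qquad j=1,\dots,2k,$$ where in $t_i(\lambda)$ the vector $\lambda\in\mathbb R^k$ is completed to $\mathbb R^m$ by the last $m-k$ entries of $\lambda^*$. Let $\gamma^*=(\lambda^*,a)$, with the first $k$ entries of $\lambda^*$, so $F(\gamma^*,0)=0$. Let $\sigma_{\min}$ be the smallest singular value of the Jacobian $\partial_\gamma F(\gamma^*,0)$, and put $$\delta_\gamma=\frac{\sigma_{\min}}{2P},\qquad \delta_w=\frac{\sigma_{\min}^2}{4P}.$$ **Theorem.** Suppose that $\partial_\gamma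 F(\gamma^*,0)$ is invertible. Then, for all $\gamma=(\lambda,\nu)$ with $\|\gamma-\gamma^*\|_2\le\delta_\gamma$ and all $p$, the function $q_\lambda$ has exactly one critical point in $[t_p^*-\delta_{0,p},\,t_p^*+\delta_{0,p}]$, so that $t_p(\lambda)$ is well defined. Moreover, for every $w\in\mathbb R^{2k}$ with $\|w\|_2\le\delta_w$ there is exactly one $(\lambda(w),\nu(w))$ with $F((\lambda(w),\nu(w)),w)=0$ and $\|(\lambda(w)-\lambda^*,\ \nu(w)-a)\|_2\le\delta_\gamma$, and it satisfies $$\left\|\begin{bmatrix}\lambda(w)-\lambda^*\\ \nu(w)-a\end{bmatrix}\right\|_2\le\frac{2}{\sigma_{\min}}\,\|w\|_2 .$$ -/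

import Mathlib

noncomputable section

namespace SuperRes

/-- The Gaussian kernel `φ(t) = exp (-t² / σ²)`. -/
def gaussianKernel (σ t : ℝ) : ℝ := Real.exp (-t ^ 2 / σ ^ 2)

/-- `c = 4 √(9 - 3√6) / e^((3 - √6)/2)`, so that `max |φ'''| = c / σ³`. -/
def cThree : ℝ := 4 * √(9 - 3 * √6) / Real.exp ((3 - √6) / 2)

/-- `c₂ = 4 + c √2 / √e`. -/
def cTwo : ℝ := 4 + cThree * √2 / √(Real.exp 1)

/-- The data of a super-resolution instance with `k` sources and `m ≥ 2k` samples: kernel width `σ`,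
sample locations `s`, source locations `t*` and weights `a`, dual variable `λ*`, the bound `Pi` on
the total mass and the box bound `τ` on the dual variable. -/
structure Model (k m : ℕ) where
  two_mul_le : 2 * k ≤ m
  σ : ℝ
  s : Fin m → ℝ
  tStar : Fin k → ℝ
  a : Fin k → ℝ
  lamStar : EuclideanSpace ℝ (Fin m)
  Pi : ℝ
  τ : ℝ

namespace Model

variable {k m : ℕ} (M : Model k m)

/-- `q_λ(t) = ∑ⱼ λⱼ φ(t - sⱼ)`; for `λ = λ*` this is the dual certificate. -/
def q (lam : EuclideanSpace ℝ (Fin m)) (t : ℝ) : ℝ :=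
  ∑ j, lam j * gaussianKernel M.σ (t - M.s j)

/-- The curvature `|q''(tₚ*)|` of the dual certificate at the `p`-th source. -/
def curv (p : Fin k) : ℝ := |iteratedDeriv 2 (M.q M.lamStar) (M.tStar p)|

/-- The radius `δ₀` of the ball around `tₚ*`. -/
def deltaZero (p : Fin k) : ℝ :=
  M.σ ^ 2 * M.curv p / (√m * (4 + 2 * cThree * (‖M.lamStar‖ / M.σ)))

/-- The radius of the ball around `λ*` for the `p`-th source. -/
def deltaLamAt (p : Fin k) : ℝ :=
  M.σ * √(Real.exp 1) * M.curv p / (2 * √(2 * m)) * M.deltaZero p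

/-- The radius `δ_λ`: the smallest one over all sources. -/
def deltaLam : ℝ := ⨅ p, M.deltaLamAt p

/-- The constant `C_{t*}` for the `p`-th source, `|tₚ(λ) - tₚ*| ≤ C_{t*} ‖λ - λ*‖₂`. -/
def CtAt (p : Fin k) : ℝ :=
  2 * √(2 * m) * (2 * M.σ + cThree * ‖M.lamStar‖) /
      (M.curv p * M.σ * √(Real.exp 1) * (4 * M.σ + cThree * ‖M.lamStar‖)) +
    2 * M.σ / (4 * M.σ + cThree * ‖M.lamStar‖)

/-- The constant `C_{t*}` valid for all sources: the largest one. -/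
def Ct : ℝ := ⨆ p, M.CtAt p

/-- `t` is a critical point of `q_λ` within distance `δ₀` of `tₚ*`. -/
def IsCritNear (p : Fin k) (lam : EuclideanSpace ℝ (Fin m)) (t : ℝ) : Prop :=
  |t - M.tStar p| ≤ M.deltaZero p ∧ deriv (M.q lam) t = 0

open Classical in
/-- The implicit function `tₚ(λ)`: the critical point of `q_λ` within distance `δ₀` of `tₚ*`
(set to `tₚ*` where there is none). -/
def tLoc (p : Fin k) (lam : EuclideanSpace ℝ (Fin m)) : ℝ :=
  if h : ∃ t, M.IsCritNear p lam t then h.choose else M.tStar p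

/-- The quantity `Δ̄₂` at `λ`, at the intermediate point `λ_δ`, for the `p`-th source, with
`B' = |∑ⱼ λⱼ* φ''(tₚ(λ_δ) - sⱼ)|`. -/
def Delta2At (p : Fin k) (lam lamδ : EuclideanSpace ℝ (Fin m)) : ℝ :=
  (cTwo * M.Ct * √m * ‖lamδ‖ + 2 * √2 / √(Real.exp 1) * M.σ) * √k /
    (M.σ ^ 2 * |iteratedDeriv 2 (M.q M.lamStar) (M.tLoc p lamδ)|
      - 2 * √m * ‖lam - M.lamStar‖) ^ 2

/-- `Δ̄₂` as a constant: the supremum over all sources, all `λ` that differ from `λ*` in the first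
`k` entries only and satisfy `‖λ - λ*‖₂ ≤ δ_λ`, and all `λ_δ` on the segment from `λ*` to `λ`. -/
def Delta2 : ℝ :=
  sSup {d | ∃ (p : Fin k) (lam lamδ : EuclideanSpace ℝ (Fin m)),
    (∀ j : Fin m, k ≤ j.val → lam j = M.lamStar j) ∧ ‖lam - M.lamStar‖ ≤ M.deltaLam ∧
    lamδ ∈ segment ℝ M.lamStar lam ∧ d = M.Delta2At p lam lamδ}

/-- The Jacobian perturbation constant `P(k, σ, Π, τ, C_{t*})`. -/
def P : ℝ :=
  √2 * k *
    (1 / M.σ ^ 2 *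
        (2 * √k * M.Ct ^ 2 * M.Pi + 4 * k * M.Ct * M.Delta2 * M.τ * M.Pi + 2 * M.Ct) +
      1 / M.σ *
        (√(2 * k) * M.Ct / √(Real.exp 1) + 4 * √k * M.Ct ^ 2 * M.Pi
          + 2 * √2 * M.Delta2 * M.Pi / √(Real.exp 1)
          + 8 * k * M.Ct * M.Delta2 * M.τ * M.Pi
          + √(2 * k) * M.Delta2 * M.Pi / √(Real.exp 1)))

/-- The full dual vector in `ℝᵐ` of `γ = (λ, ν) ∈ ℝᵏ × ℝᵏ`: the first `k` entries are those of `γ`,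
the others are those of `λ*`. -/
def lamOf (γ : EuclideanSpace ℝ (Fin k ⊕ Fin k)) : EuclideanSpace ℝ (Fin m) :=
  WithLp.toLp 2 fun j => if h : j.val < k then γ (Sum.inl ⟨j.val, h⟩) else M.lamStar j

/-- The `j`-th sample location, for `j` among the first `2k` samples. -/
def sFirst (j : Fin (2 * k)) : ℝ := M.s (Fin.castLE M.two_mul_le j)

/-- The map `F(γ, w)` with `γ = (λ, ν)`:
`Fⱼ = ∑ᵢ aᵢ φ(tᵢ* - sⱼ) + wⱼ - ∑ᵢ νᵢ φ(tᵢ(λ) - sⱼ)` for `j = 1, …, 2k`. -/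
def F (γ : EuclideanSpace ℝ (Fin k ⊕ Fin k)) (w : EuclideanSpace ℝ (Fin (2 * k))) :
    EuclideanSpace ℝ (Fin (2 * k)) :=
  WithLp.toLp 2 fun j =>
    (∑ i, M.a i * gaussianKernel M.σ (M.tStar i - M.sFirst j)) + w j
      - ∑ i, γ (Sum.inr i) * gaussianKernel M.σ (M.tLoc i (M.lamOf γ) - M.sFirst j)

/-- `γ* = (λ*, a)`, with the first `k` entries of `λ*`. -/
def gammaStar : EuclideanSpace ℝ (Fin k ⊕ Fin k) :=
  WithLp.toLp 2 (Sum.elim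
    (fun i => M.lamStar (Fin.castLE (le_trans (Nat.le_mul_of_pos_left k two_pos) M.two_mul_le) i))
    M.a)

/-- The Jacobian `∂_γ F(γ*, 0)`. -/
def jac : EuclideanSpace ℝ (Fin k ⊕ Fin k) →L[ℝ] EuclideanSpace ℝ (Fin (2 * k)) :=
  fderiv ℝ (fun γ => M.F γ 0) M.gammaStar

/-- `σ_min(∂_γ F(γ*, 0))`: the last of its `2k` singular values in decreasing order. -/
def sigmaMin : ℝ := M.jac.toLinearMap.singularValues (2 * k - 1)

/-- `δ_γ = σ_min / (2P)`. -/
def deltaGamma : ℝ := M.sigmaMin / (2 * M.P)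

/-- `δ_w = σ_min² / (4P)`. -/
def deltaW : ℝ := M.sigmaMin ^ 2 / (4 * M.P)

end Model

end SuperRes

end

/-! The argument is a quantitative inverse function theorem for γ ↦ F(γ, 0) at γ*. Since w enters F
additively, solving F(γ, w) = 0 means solving F(γ, 0) = -w. Suppose the Jacobian differs from J =
∂_γ F(γ*, 0) by at most P‖γ - γ*‖. On the ball of radius δ_γ = σ_min/(2P) this is at most σ_min/2,
so by the mean value inequality F(·, 0) differs from J by a (σ_min/2)-Lipschitz map. As ‖Jv‖ ≥
σ_min‖v‖, the map expands distances by at least σ_min/2, which gives uniqueness and the error bound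
(`half_sigmaMin_mul_norm_le`). It also covers the ball of radius (σ_min - σ_min/2) δ_γ = δ_w around
0 (`exists_F_eq_zero`).

Two points need work. One is that every tₚ(λ) is well defined and differentiable on the whole ball.
If λ is close to λ* in the sense of `InRange`, then on the interval of radius δ₀ the function q_λ''
is bounded away from 0, and q_λ' has opposite signs at the two ends; this gives a unique critical
point, which the implicit function theorem makes differentiable. The ball of radius δ_γ lies in this
range without further assumption: σ_min is at most the norm of the first column of J
(`sigmaMin_le`), while P is large enough that this norm divided by 2P is below the admissible radius
(`column_bound_le`, `inRange`).

The other is the Lipschitz constant P (`norm_FDeriv_sub_le`). It comes from sup bounds on φ', φ'',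
φ''', which control tₚ, ∂tₚ and φ'(tₚ - s)∂tₚ, with C_{t*} and Δ̄₂ absorbing the constants. -/

noncomputable section

namespace SuperRes

open Real Filter
open scoped Topology

/-! ### Derivatives of the Gaussian kernel and their sharp or sufficient sup bounds. -/

/-- The first derivative of the Gaussian kernel. -/
def gaussianD1 (σ t : ℝ) : ℝ := -(2 * t / σ ^ 2) * gaussianKernel σ t

/-- The second derivative of the Gaussian kernel. -/
def gaussianD2 (σ t : ℝ) : ℝ := (4 * t ^ 2 / σ ^ 4 - 2 / σ ^ 2) * gaussianKernel σ t

/-- The third derivative of the Gaussian kernel. -/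
def gaussianD3 (σ t : ℝ) : ℝ := (12 * t / σ ^ 4 - 8 * t ^ 3 / σ ^ 6) * gaussianKernel σ t

theorem hasDerivAt_gaussianKernel (σ t : ℝ) :
    HasDerivAt (gaussianKernel σ) (gaussianD1 σ t) t := by
  have h : HasDerivAt (fun t : ℝ => -t ^ 2 / σ ^ 2) (-(2 * t) / σ ^ 2) t := by
    simpa using ((hasDerivAt_pow 2 t).neg.div_const (σ ^ 2))
  refine h.exp.congr_deriv ?_
  rw [gaussianD1, gaussianKernel]
  ring

theorem hasDerivAt_gaussianD1 (σ t : ℝ) : HasDerivAt (gaussianD1 σ) (gaussianD2 σ t) t := by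
  have h : HasDerivAt (fun t : ℝ => -(2 * t / σ ^ 2)) (-(2 / σ ^ 2)) t := by
    simpa using (((hasDerivAt_id t).const_mul 2).div_const (σ ^ 2)).fun_neg
  refine (h.mul (hasDerivAt_gaussianKernel σ t)).congr_deriv ?_
  rw [gaussianD2, gaussianD1]
  ring

theorem hasDerivAt_gaussianD2 (σ t : ℝ) : HasDerivAt (gaussianD2 σ) (gaussianD3 σ t) t := by
  have h : HasDerivAt (fun t : ℝ => 4 * t ^ 2 / σ ^ 4 - 2 / σ ^ 2) (4 * (2 * t) / σ ^ 4) t := by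
    simpa using (((hasDerivAt_pow 2 t).const_mul 4).div_const (σ ^ 4)).sub_const (2 / σ ^ 2)
  refine (h.mul (hasDerivAt_gaussianKernel σ t)).congr_deriv ?_
  rw [gaussianD3, gaussianD1]
  ring

theorem gaussianKernel_pos (σ t : ℝ) : 0 < gaussianKernel σ t := exp_pos _

theorem gaussianKernel_le_one (σ t : ℝ) : gaussianKernel σ t ≤ 1 := by
  rw [gaussianKernel, exp_le_one_iff, neg_div]
  have : 0 ≤ t ^ 2 / σ ^ 2 := by positivity
  linarith

theorem gaussianKernel_eq (σ t : ℝ) : gaussianKernel σ t = exp (-(t / σ) ^ 2) := by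
  rw [gaussianKernel, div_pow, neg_div]

/-- `x e^{-x} ≤ e⁻¹` in the form `x ≤ e^{x-1}`. -/
theorem le_exp_sub_one (x : ℝ) : x ≤ exp (x - 1) := by
  linarith [add_one_le_exp (x - 1)]

/-- Squaring reduces the claim to x e^{-x} ≤ e⁻¹ at x = 2u². -/
theorem two_mul_abs_mul_exp_neg_sq_le (u : ℝ) :
    2 * |u| * exp (-u ^ 2) ≤ √2 / √(exp 1) := by
  have h : (2 * u ^ 2) * exp (-(2 * u ^ 2)) ≤ exp (-1) := by
    calc (2 * u ^ 2) * exp (-(2 * u ^ 2)) ≤ exp (2 * u ^ 2 - 1) * exp (-(2 * u ^ 2)) := by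
          gcongr; exact le_exp_sub_one _
      _ = exp (-1) := by rw [← exp_add]; ring_nf
  rw [← sqrt_div (by norm_num)]
  apply le_sqrt_of_sq_le
  have e : exp (-u ^ 2) ^ 2 = exp (-(2 * u ^ 2)) := by
    rw [← exp_nat_mul]; congr 1; push_cast; ring
  rw [mul_pow, mul_pow, sq_abs, e, div_eq_mul_inv, ← exp_neg]
  linarith

theorem abs_gaussianD1_le {σ : ℝ} (hσ : 0 < σ) (t : ℝ) :
    |gaussianD1 σ t| ≤ √2 / (√(exp 1) * σ) := by
  have h := two_mul_abs_mul_exp_neg_sq_le (t / σ)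
  rw [← gaussianKernel_eq] at h
  have e : |gaussianD1 σ t| = 2 * |t / σ| * gaussianKernel σ t / σ := by
    rw [gaussianD1, abs_mul, abs_of_pos (gaussianKernel_pos σ t), abs_neg, abs_div, abs_div,
      abs_mul, abs_of_pos hσ, abs_of_pos (by positivity : (0 : ℝ) < σ ^ 2), abs_two]
    field_simp
  rw [e, ← div_div]
  gcongr

theorem abs_gaussianD2_le {σ : ℝ} (hσ : 0 < σ) (t : ℝ) : |gaussianD2 σ t| ≤ 2 / σ ^ 2 := by
  have key : |4 * (t / σ) ^ 2 - 2| * gaussianKernel σ t ≤ 2 := by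
    have h1 := gaussianKernel_le_one σ t
    have h0 := gaussianKernel_pos σ t
    have hx : (t / σ) ^ 2 * gaussianKernel σ t ≤ exp (-1) := by
      rw [gaussianKernel_eq]
      calc (t / σ) ^ 2 * exp (-(t / σ) ^ 2)
          ≤ exp ((t / σ) ^ 2 - 1) * exp (-(t / σ) ^ 2) := by gcongr; exact le_exp_sub_one _
        _ = exp (-1) := by rw [← exp_add]; ring_nf
    have he : exp (-1) ≤ 1 / 2 := by
      rw [exp_neg, inv_le_comm₀ (exp_pos _) (by norm_num)]
      linarith [add_one_le_exp 1]
    have hp : 0 ≤ (t / σ) ^ 2 * gaussianKernel σ t := by positivity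
    rcases abs_cases (4 * (t / σ) ^ 2 - 2) with ⟨h, _⟩ | ⟨h, _⟩ <;> rw [h] <;> nlinarith
  have e : |gaussianD2 σ t| = |4 * (t / σ) ^ 2 - 2| * gaussianKernel σ t / σ ^ 2 := by
    have : gaussianD2 σ t = (4 * (t / σ) ^ 2 - 2) * gaussianKernel σ t / σ ^ 2 := by
      rw [gaussianD2]; field_simp
    rw [this, abs_div, abs_mul, abs_of_pos (gaussianKernel_pos σ t),
      abs_of_pos (by positivity : (0 : ℝ) < σ ^ 2)]
  rw [e]
  gcongr

theorem sqrt_six_bounds : (2.449 : ℝ) < √6 ∧ √6 < 2.4495 :=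
  ⟨lt_sqrt_of_sq_lt (by norm_num), (sqrt_lt' (by norm_num)).2 (by norm_num)⟩

theorem sq_cThree : cThree ^ 2 = 16 * (9 - 3 * √6) * exp (-(3 - √6)) := by
  have h6 := sqrt_six_bounds
  rw [cThree, div_pow, mul_pow, sq_sqrt (by linarith), ← exp_nat_mul, exp_neg]
  push_cast
  rw [mul_div_cancel₀ _ (two_ne_zero), div_eq_mul_inv]
  norm_num

/-- A crude lower bound for c; the later numerical comparisons need no more than this. -/
theorem three_le_cThree : 3 ≤ cThree := by
  have h6 := sqrt_six_bounds
  refine le_of_sq_le_sq ?_ (by rw [cThree]; positivity)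
  rw [sq_cThree]
  have h1 : 1 - (3 - √6) ≤ exp (-(3 - √6)) := by linarith [add_one_le_exp (-(3 - √6))]
  have h2 : (9 - 3 * 2.4495 : ℝ) ≤ 9 - 3 * √6 := by linarith
  have h3 : (0.449 : ℝ) ≤ exp (-(3 - √6)) := by linarith
  calc (3 : ℝ) ^ 2 ≤ 16 * (9 - 3 * 2.4495) * 0.449 := by norm_num
    _ ≤ _ := by gcongr

/-- With v = (t/σ)² the left side is the square of σ³φ'''. For 2v ≤ 3 its maximum is at v₀ = (3 -
√6)/2, where 3 - 2v₀ = √6. Applying x ≤ e^{x-1} to v/v₀ and to (3 - 2v)/√6 is sharp there, and since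
v₀ is critical the terms linear in v cancel in the exponent. For 2v > 3 crude bounds give 8 < 9 ≤
c². -/
theorem sq_abs_cubic_mul_exp_le {v : ℝ} (hv : 0 ≤ v) :
    16 * v * (3 - 2 * v) ^ 2 * exp (-(2 * v)) ≤ cThree ^ 2 := by
  have h6 := sqrt_six_bounds
  have hs : √6 * √6 = 6 := mul_self_sqrt (by norm_num)
  rcases le_or_gt (2 * v) 3 with hv3 | hv3
  · rw [sq_cThree]
    set v₀ : ℝ := (3 - √6) / 2 with hv₀
    have hv₀pos : 0 < v₀ := by rw [hv₀]; linarith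
    have h1 : v ≤ v₀ * exp (v / v₀ - 1) := by
      rw [← div_le_iff₀' hv₀pos]; exact le_exp_sub_one _
    have h2 : 3 - 2 * v ≤ √6 * exp ((3 - 2 * v) / √6 - 1) := by
      rw [← div_le_iff₀' (by linarith)]; exact le_exp_sub_one _
    have h3 : (0 : ℝ) ≤ 3 - 2 * v := by linarith
    have hv₀i : v / v₀ = 2 * v * (3 + √6) / 3 := by
      rw [hv₀]
      have : (3 : ℝ) - √6 ≠ 0 := by linarith
      field_simp
      nlinarith
    have h6i : (3 - 2 * v) / √6 = (3 - 2 * v) * √6 / 6 := by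
      have : √6 ≠ 0 := by linarith
      field_simp
      nlinarith
    calc 16 * v * (3 - 2 * v) ^ 2 * exp (-(2 * v))
        ≤ 16 * (v₀ * exp (v / v₀ - 1)) * (√6 * exp ((3 - 2 * v) / √6 - 1)) ^ 2
            * exp (-(2 * v)) := by gcongr
      _ = 16 * (v₀ * √6 ^ 2) * (exp (v / v₀ - 1) * exp ((3 - 2 * v) / √6 - 1) ^ 2
            * exp (-(2 * v))) := by ring
      _ = 16 * (9 - 3 * √6) * exp (-(3 - √6)) := by
          rw [← exp_nat_mul, ← exp_add, ← exp_add, hv₀i, h6i, sq_sqrt (by norm_num), hv₀]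
          congr 2
          · ring
          · push_cast; ring
  · have h1 : v * exp (-v) ≤ 1 / 2 := by
      have h := le_exp_sub_one v
      calc v * exp (-v) ≤ exp (v - 1) * exp (-v) := by gcongr
        _ = exp (-1) := by rw [← exp_add]; ring_nf
        _ ≤ 1 / 2 := by
          rw [exp_neg, inv_le_comm₀ (exp_pos _) (by norm_num)]
          linarith [add_one_le_exp 1]
    have h2 : (3 - 2 * v) ^ 2 * exp (-v) ≤ 1 := by
      -- The divisor 4 makes the squared exponential e^{v - 7/2}, which cancels e^{-v}.
      have h : (2 * v - 3) / 4 ≤ exp ((2 * v - 3) / 4 - 1) := le_exp_sub_one _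
      have h7 : (16 : ℝ) ≤ exp (7 / 2) := by
        have e : exp (7 / 2) = exp (1 / 2) ^ 7 := by
          rw [← exp_nat_mul]; congr 1; norm_num
        have h' : (1 / 2 + 1 : ℝ) ^ 7 ≤ exp (1 / 2) ^ 7 := by
          gcongr; exact add_one_le_exp _
        rw [e]
        exact le_trans (by norm_num) h'
      calc (3 - 2 * v) ^ 2 * exp (-v) = 16 * ((2 * v - 3) / 4) ^ 2 * exp (-v) := by ring
        _ ≤ 16 * exp ((2 * v - 3) / 4 - 1) ^ 2 * exp (-v) := by
          gcongr
        _ = 16 * (exp (7 / 2))⁻¹ := by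
          rw [← exp_nat_mul, mul_assoc, ← exp_add, ← exp_neg]
          congr 2
          push_cast
          ring
        _ ≤ 1 := by
          rw [← div_eq_mul_inv, div_le_one (exp_pos _)]
          exact h7
    have h3 := three_le_cThree
    calc 16 * v * (3 - 2 * v) ^ 2 * exp (-(2 * v))
        = 16 * (v * exp (-v)) * ((3 - 2 * v) ^ 2 * exp (-v)) := by
          rw [show -(2 * v) = -v + -v by ring, exp_add]; ring
      _ ≤ 16 * (1 / 2) * 1 := by gcongr
      _ ≤ cThree ^ 2 := by nlinarith

theorem abs_gaussianD3_le {σ : ℝ} (hσ : 0 < σ) (t : ℝ) : |gaussianD3 σ t| ≤ cThree / σ ^ 3 := by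
  have key := sq_abs_cubic_mul_exp_le (sq_nonneg (t / σ))
  have e : gaussianD3 σ t
      = (4 * (t / σ) * (3 - 2 * (t / σ) ^ 2) * exp (-(t / σ) ^ 2)) / σ ^ 3 := by
    rw [gaussianD3, gaussianKernel_eq]; field_simp; ring
  rw [e, abs_div, abs_of_pos (by positivity : (0 : ℝ) < σ ^ 3)]
  gcongr
  refine abs_le_of_sq_le_sq ?_ (by linarith [three_le_cThree])
  refine le_trans (le_of_eq ?_) key
  have : exp (-(t / σ) ^ 2) ^ 2 = exp (-(2 * (t / σ) ^ 2)) := by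
    rw [← exp_nat_mul]; congr 1; push_cast; ring
  rw [← this]
  ring

/-- A function whose derivative is bounded by `C` is Lipschitz. -/
theorem abs_sub_le_of_hasDerivAt {f f' : ℝ → ℝ} {C : ℝ} (hf : ∀ t, HasDerivAt f (f' t) t)
    (hC : ∀ t, |f' t| ≤ C) (x y : ℝ) : |f x - f y| ≤ C * |x - y| :=
  convex_univ.norm_image_sub_le_of_norm_hasDerivWithin_le
    (fun t _ => (hf t).hasDerivWithinAt) (fun t _ => hC t) (Set.mem_univ y) (Set.mem_univ x)

theorem abs_gaussianKernel_sub_le {σ : ℝ} (hσ : 0 < σ) (x y : ℝ) :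
    |gaussianKernel σ x - gaussianKernel σ y| ≤ √2 / (√(exp 1) * σ) * |x - y| :=
  abs_sub_le_of_hasDerivAt (hasDerivAt_gaussianKernel σ) (abs_gaussianD1_le hσ) x y

theorem abs_gaussianD1_sub_le {σ : ℝ} (hσ : 0 < σ) (x y : ℝ) :
    |gaussianD1 σ x - gaussianD1 σ y| ≤ 2 / σ ^ 2 * |x - y| :=
  abs_sub_le_of_hasDerivAt (hasDerivAt_gaussianD1 σ) (abs_gaussianD2_le hσ) x y

theorem abs_gaussianD2_sub_le {σ : ℝ} (hσ : 0 < σ) (x y : ℝ) :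
    |gaussianD2 σ x - gaussianD2 σ y| ≤ cThree / σ ^ 3 * |x - y| :=
  abs_sub_le_of_hasDerivAt (hasDerivAt_gaussianD2 σ) (abs_gaussianD3_le hσ) x y

/-- Cauchy--Schwarz: `|∑ xᵢ fᵢ| ≤ b √n ‖x‖₂` when all `|fᵢ| ≤ b`. -/
theorem abs_sum_mul_le {n : ℕ} (x f : Fin n → ℝ) {b : ℝ} (hf : ∀ i, |f i| ≤ b) :
    |∑ i, x i * f i| ≤ √n * √(∑ i, x i ^ 2) * b := by
  rcases Nat.eq_zero_or_pos n with rfl | hn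
  · simp
  have hb : 0 ≤ b := (abs_nonneg _).trans (hf ⟨0, hn⟩)
  have h : (∑ i, x i * f i) ^ 2 ≤ (√n * √(∑ i, x i ^ 2) * b) ^ 2 := by
    calc (∑ i, x i * f i) ^ 2 ≤ (∑ i, x i ^ 2) * ∑ i, f i ^ 2 :=
          Finset.sum_mul_sq_le_sq_mul_sq _ _ _
      _ ≤ (∑ i, x i ^ 2) * ∑ _i : Fin n, b ^ 2 := by
          refine mul_le_mul_of_nonneg_left (Finset.sum_le_sum fun i _ => ?_)
            (Finset.sum_nonneg fun i _ => sq_nonneg _)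
          exact sq_le_sq' (abs_le.1 (hf i)).1 (abs_le.1 (hf i)).2
      _ = (√n * √(∑ i, x i ^ 2) * b) ^ 2 := by
          rw [mul_pow, mul_pow, sq_sqrt (Nat.cast_nonneg _),
            sq_sqrt (Finset.sum_nonneg fun i _ => sq_nonneg _)]
          simp; ring
  exact abs_le_of_sq_le_sq h (by positivity)

/-! ### Derivatives of q_λ and its perturbation in the first k entries. -/

namespace Model

variable {k m : ℕ} (M : Model k m)

/-- The first derivative of `q_λ`. -/
def q1 (lam : EuclideanSpace ℝ (Fin m)) (t : ℝ) : ℝ :=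
  ∑ j, lam j * gaussianD1 M.σ (t - M.s j)

/-- The second derivative of `q_λ`. -/
def q2 (lam : EuclideanSpace ℝ (Fin m)) (t : ℝ) : ℝ :=
  ∑ j, lam j * gaussianD2 M.σ (t - M.s j)

theorem hasDerivAt_q (lam : EuclideanSpace ℝ (Fin m)) (t : ℝ) :
    HasDerivAt (M.q lam) (M.q1 lam t) t :=
  HasDerivAt.fun_sum fun j _ =>
    ((hasDerivAt_gaussianKernel M.σ (t - M.s j)).comp_sub_const t (M.s j)).const_mul (lam j)

theorem hasDerivAt_q1 (lam : EuclideanSpace ℝ (Fin m)) (t : ℝ) :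
    HasDerivAt (M.q1 lam) (M.q2 lam t) t :=
  HasDerivAt.fun_sum fun j _ =>
    ((hasDerivAt_gaussianD1 M.σ (t - M.s j)).comp_sub_const t (M.s j)).const_mul (lam j)

theorem deriv_q (lam : EuclideanSpace ℝ (Fin m)) : deriv (M.q lam) = M.q1 lam :=
  funext fun t => (M.hasDerivAt_q lam t).deriv

theorem iteratedDeriv_two_q (lam : EuclideanSpace ℝ (Fin m)) :
    iteratedDeriv 2 (M.q lam) = M.q2 lam := by
  rw [iteratedDeriv_succ, iteratedDeriv_one, deriv_q]
  exact funext fun t => (M.hasDerivAt_q1 lam t).deriv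

theorem curv_eq (p : Fin k) : M.curv p = |M.q2 M.lamStar (M.tStar p)| := by
  rw [curv, iteratedDeriv_two_q]

theorem isCritNear_iff (p : Fin k) (lam : EuclideanSpace ℝ (Fin m)) (t : ℝ) :
    M.IsCritNear p lam t ↔ |t - M.tStar p| ≤ M.deltaZero p ∧ M.q1 lam t = 0 := by
  rw [IsCritNear, deriv_q]

/-- The standing assumptions of the implicit function theorem, in terms of the derivatives of the
dual certificate. -/
structure Nondegenerate : Prop where
  k_pos : 0 < k
  σ_pos : 0 < M.σ
  a_pos : ∀ i, 0 < M.a i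
  sum_a_le : ∑ i, M.a i ≤ M.Pi
  abs_lam_le : ∀ j, |M.lamStar j| ≤ M.τ
  q_one : ∀ i, M.q M.lamStar (M.tStar i) = 1
  crit : ∀ i, M.q1 M.lamStar (M.tStar i) = 0
  curv_pos : ∀ i, 0 < M.curv i

theorem le_m {k m : ℕ} (M : Model k m) : k ≤ m :=
  le_trans (Nat.le_mul_of_pos_left k two_pos) M.two_mul_le

/-- The locations of the first `k` samples. -/
def sHead (l : Fin k) : ℝ := M.s (Fin.castLE M.le_m l)

/-- Only k entries move, so perturbation estimates carry √k instead of √m. Together with 2k ≤ m this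
provides the slack used in `grad_bound_le_Ct`. -/
theorem sum_lamOf_mul (γ : EuclideanSpace ℝ (Fin k ⊕ Fin k)) (f : Fin m → ℝ) :
    ∑ j, M.lamOf γ j * f j = ∑ j, M.lamStar j * f j
      + ∑ l, (γ - M.gammaStar) (Sum.inl l) * f (Fin.castLE M.le_m l) := by
  rw [← sub_eq_iff_eq_add', ← Finset.sum_sub_distrib]
  symm
  refine Finset.sum_of_injOn (Fin.castLE M.le_m) (Fin.castLE_injective _).injOn
    (fun _ _ => Finset.mem_coe.2 (Finset.mem_univ _)) ?_ ?_
  · intro j _ hj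
    have : ¬ j.val < k := fun h => hj ⟨⟨j.val, h⟩, by simp, rfl⟩
    simp [lamOf, this]
  · intro l _
    simp only [lamOf, gammaStar, PiLp.sub_apply, Fin.val_castLE, Fin.is_lt, dif_pos, Fin.eta,
      Sum.elim_inl]
    ring

theorem q1_lamOf (γ : EuclideanSpace ℝ (Fin k ⊕ Fin k)) (t : ℝ) :
    M.q1 (M.lamOf γ) t = M.q1 M.lamStar t
      + ∑ l, (γ - M.gammaStar) (Sum.inl l) * gaussianD1 M.σ (t - M.sHead l) :=
  M.sum_lamOf_mul γ fun j => gaussianD1 M.σ (t - M.s j)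

theorem q2_lamOf (γ : EuclideanSpace ℝ (Fin k ⊕ Fin k)) (t : ℝ) :
    M.q2 (M.lamOf γ) t = M.q2 M.lamStar t
      + ∑ l, (γ - M.gammaStar) (Sum.inl l) * gaussianD2 M.σ (t - M.sHead l) :=
  M.sum_lamOf_mul γ fun j => gaussianD2 M.σ (t - M.s j)

theorem lamOf_gammaStar : M.lamOf M.gammaStar = M.lamStar := by
  ext j
  by_cases h : j.val < k
  · simp [lamOf, gammaStar]
  · simp [lamOf, h]

end Model

/-- The Euclidean norm of the `λ`-part of `γ = (λ, ν)`. -/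
def headNorm {k : ℕ} (γ : EuclideanSpace ℝ (Fin k ⊕ Fin k)) : ℝ := √(∑ i, γ (Sum.inl i) ^ 2)

/-- The Euclidean norm of the `ν`-part of `γ = (λ, ν)`. -/
def tailNorm {k : ℕ} (γ : EuclideanSpace ℝ (Fin k ⊕ Fin k)) : ℝ := √(∑ i, γ (Sum.inr i) ^ 2)

theorem headNorm_nonneg {k : ℕ} (γ : EuclideanSpace ℝ (Fin k ⊕ Fin k)) : 0 ≤ headNorm γ :=
  sqrt_nonneg _

theorem sq_headNorm_add_sq_tailNorm {k : ℕ} (γ : EuclideanSpace ℝ (Fin k ⊕ Fin k)) :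
    headNorm γ ^ 2 + tailNorm γ ^ 2 = ‖γ‖ ^ 2 := by
  rw [EuclideanSpace.norm_sq_eq, Fintype.sum_sum_type, headNorm, tailNorm,
    sq_sqrt (Finset.sum_nonneg fun i _ => sq_nonneg _),
    sq_sqrt (Finset.sum_nonneg fun i _ => sq_nonneg _)]
  simp

theorem headNorm_le {k : ℕ} (γ : EuclideanSpace ℝ (Fin k ⊕ Fin k)) : headNorm γ ≤ ‖γ‖ :=
  le_of_sq_le_sq (by nlinarith [sq_headNorm_add_sq_tailNorm γ, sq_nonneg (tailNorm γ)])
    (norm_nonneg _)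

/-- Cauchy–Schwarz in ℝ² for (head, tail) of γ and (tail, head) of γ'. It lets the two mixed terms
of the Jacobian variation be bounded together, without a factor 2. -/
theorem headNorm_mul_add_tailNorm_mul_le {k : ℕ} (γ γ' : EuclideanSpace ℝ (Fin k ⊕ Fin k)) :
    headNorm γ * tailNorm γ' + tailNorm γ * headNorm γ' ≤ ‖γ‖ * ‖γ'‖ := by
  refine le_of_sq_le_sq ?_ (by positivity)
  rw [mul_pow, ← sq_headNorm_add_sq_tailNorm, ← sq_headNorm_add_sq_tailNorm]
  nlinarith [sq_nonneg (headNorm γ * headNorm γ' - tailNorm γ * tailNorm γ')]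

namespace Model

variable {k m : ℕ} {M : Model k m}

theorem sqrt_sum_lamStar_sq : √(∑ j, M.lamStar j ^ 2) = ‖M.lamStar‖ := by
  rw [EuclideanSpace.norm_eq]; simp

theorem abs_q1_lamOf_sub_le (hσ : 0 < M.σ) (γ : EuclideanSpace ℝ (Fin k ⊕ Fin k)) (t : ℝ) :
    |M.q1 (M.lamOf γ) t - M.q1 M.lamStar t|
      ≤ √k * headNorm (γ - M.gammaStar) * (√2 / (√(exp 1) * M.σ)) := by
  rw [q1_lamOf, add_sub_cancel_left]
  exact abs_sum_mul_le _ _ fun l => abs_gaussianD1_le hσ _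

theorem abs_q2_lamOf_sub_le (hσ : 0 < M.σ) (γ : EuclideanSpace ℝ (Fin k ⊕ Fin k)) (t : ℝ) :
    |M.q2 (M.lamOf γ) t - M.q2 M.lamStar t|
      ≤ √k * headNorm (γ - M.gammaStar) * (2 / M.σ ^ 2) := by
  rw [q2_lamOf, add_sub_cancel_left]
  exact abs_sum_mul_le _ _ fun l => abs_gaussianD2_le hσ _

theorem abs_q2_sub_le (hσ : 0 < M.σ) (x y : ℝ) :
    |M.q2 M.lamStar x - M.q2 M.lamStar y|
      ≤ √m * ‖M.lamStar‖ * (cThree / M.σ ^ 3 * |x - y|) := by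
  rw [q2, q2, ← Finset.sum_sub_distrib, ← sqrt_sum_lamStar_sq]
  simp only [← mul_sub]
  refine abs_sum_mul_le _ _ fun l => (abs_gaussianD2_sub_le hσ _ _).trans_eq ?_
  rw [sub_sub_sub_cancel_right]

theorem curv_le (hσ : 0 < M.σ) (p : Fin k) : M.curv p ≤ √m * ‖M.lamStar‖ * (2 / M.σ ^ 2) := by
  rw [curv_eq, ← sqrt_sum_lamStar_sq]
  exact abs_sum_mul_le _ _ fun l => abs_gaussianD2_le hσ _

namespace Nondegenerate

/-- The value q(t*) = 1 with φ ≤ 1 prevents λ* from being small. -/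
theorem one_le (hM : M.Nondegenerate) : 1 ≤ √m * ‖M.lamStar‖ := by
  have h : |M.q M.lamStar (M.tStar ⟨0, hM.k_pos⟩)| ≤ √m * √(∑ j, M.lamStar j ^ 2) * 1 :=
    abs_sum_mul_le _ _ fun l => by
      rw [abs_of_pos (gaussianKernel_pos _ _)]
      exact gaussianKernel_le_one _ _
  rwa [hM.q_one, abs_one, mul_one, sqrt_sum_lamStar_sq] at h

end Nondegenerate

end Model

theorem sqrt_exp_one_le : √(exp 1) ≤ 1.2 * √2 := by
  rw [sqrt_le_left (by positivity), mul_pow, sq_sqrt (by norm_num)]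
  linarith [exp_one_lt_d9]

/-! ### Existence and uniqueness of the critical point near each source. -/

namespace Model

variable {k m : ℕ} {M : Model k m}

/-- The ratio `‖λ*‖₂ / σ`. -/
def ell (M : Model k m) : ℝ := ‖M.lamStar‖ / M.σ

/-- The denominator `4 + 2c‖λ*‖₂/σ` of the radii `δ₀`. -/
def radDen (M : Model k m) : ℝ := 4 + 2 * cThree * M.ell

/-- The first `k` entries of `γ` are so close to those of `γ*` that `tₚ(λ)` is well defined. -/
def InRange (M : Model k m) (p : Fin k) (γ : EuclideanSpace ℝ (Fin k ⊕ Fin k)) : Prop :=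
  √k * headNorm (γ - M.gammaStar) < √m / 4 * M.deltaLamAt p

namespace Nondegenerate

theorem m_pos (hM : M.Nondegenerate) : 0 < m := hM.k_pos.trans_le M.le_m

theorem sqrt_m_pos (hM : M.Nondegenerate) : 0 < √(m : ℝ) :=
  sqrt_pos.2 (Nat.cast_pos.2 hM.m_pos)

theorem sqrt_two_mul_sqrt_le (M : Model k m) : √2 * √(k : ℝ) ≤ √(m : ℝ) := by
  rw [← sqrt_mul (by norm_num)]
  exact sqrt_le_sqrt (by exact_mod_cast M.two_mul_le)

theorem one_le_sqrt_k (hM : M.Nondegenerate) : 1 ≤ √(k : ℝ) :=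
  one_le_sqrt.2 (by exact_mod_cast hM.k_pos)

theorem sqrt_two_le (hM : M.Nondegenerate) : √2 ≤ √(m : ℝ) :=
  le_trans (le_mul_of_one_le_right (by positivity) hM.one_le_sqrt_k) (sqrt_two_mul_sqrt_le M)

theorem norm_lamStar_pos (hM : M.Nondegenerate) : 0 < ‖M.lamStar‖ := by
  have := hM.one_le
  by_contra! h
  have := mul_nonpos_of_nonneg_of_nonpos (sqrt_nonneg (m : ℝ)) h
  linarith

theorem ell_pos (hM : M.Nondegenerate) : 0 < M.ell := div_pos hM.norm_lamStar_pos hM.σ_pos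

theorem radDen_pos (hM : M.Nondegenerate) : 0 < M.radDen := by
  have := hM.ell_pos
  have := three_le_cThree
  rw [radDen]; positivity

theorem norm_lamStar_eq (hM : M.Nondegenerate) : ‖M.lamStar‖ = M.ell * M.σ := by
  rw [ell, div_mul_cancel₀ _ hM.σ_pos.ne']

theorem deltaZero_eq (M : Model k m) (p : Fin k) :
    M.deltaZero p = M.σ ^ 2 * M.curv p / (√m * M.radDen) := rfl

theorem deltaZero_pos (hM : M.Nondegenerate) (p : Fin k) : 0 < M.deltaZero p := by
  have := hM.sqrt_m_pos
  have := hM.radDen_pos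
  have := hM.curv_pos p
  have := hM.σ_pos
  rw [deltaZero_eq]; positivity

theorem deltaZero_le (hM : M.Nondegenerate) (p : Fin k) :
    M.deltaZero p ≤ 2 * M.ell * M.σ / M.radDen := by
  have h1 := hM.sqrt_m_pos
  have h2 := hM.radDen_pos
  have h3 := hM.σ_pos
  have h4 := curv_le h3 p
  rw [deltaZero_eq, div_le_div_iff₀ (by positivity) h2, mul_assoc 2, ← hM.norm_lamStar_eq]
  calc M.σ ^ 2 * M.curv p * M.radDen
      ≤ M.σ ^ 2 * (√m * ‖M.lamStar‖ * (2 / M.σ ^ 2)) * M.radDen := by gcongr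
    _ = _ := by field_simp

/-- This is the purpose of δ₀: times the Lipschitz constant of q'' it equals the fraction cℓ/(4 +
2cℓ) < 1/2 of the curvature, where ℓ = ‖λ*‖₂/σ. -/
theorem abs_q2_sub_le_mul (hM : M.Nondegenerate) {p : Fin k} {t : ℝ}
    (ht : |t - M.tStar p| ≤ M.deltaZero p) :
    |M.q2 M.lamStar t - M.q2 M.lamStar (M.tStar p)|
      ≤ M.curv p * (cThree * M.ell / M.radDen) := by
  have h1 := hM.sqrt_m_pos
  have h2 := hM.radDen_pos
  have h3 := hM.σ_pos
  have h4 := three_le_cThree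
  refine (abs_q2_sub_le h3 _ _).trans ?_
  calc √m * ‖M.lamStar‖ * (cThree / M.σ ^ 3 * |t - M.tStar p|)
      ≤ √m * ‖M.lamStar‖ * (cThree / M.σ ^ 3 * M.deltaZero p) := by gcongr
    _ = _ := by
      rw [deltaZero_eq, hM.norm_lamStar_eq]
      field_simp

theorem lip_factor (hM : M.Nondegenerate) :
    1 - cThree * M.ell / M.radDen = (4 + cThree * M.ell) / M.radDen := by
  have h2 := hM.radDen_pos
  rw [eq_div_iff h2.ne', sub_mul, div_mul_cancel₀ _ h2.ne', radDen]
  ring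

theorem factor_le_half (hM : M.Nondegenerate) : cThree * M.ell / M.radDen ≤ 1 / 2 := by
  rw [div_le_iff₀ hM.radDen_pos, radDen]
  linarith

theorem le_abs_q2_lamStar (hM : M.Nondegenerate) {p : Fin k} {t : ℝ}
    (ht : |t - M.tStar p| ≤ M.deltaZero p) :
    M.curv p * ((4 + cThree * M.ell) / M.radDen) ≤ |M.q2 M.lamStar t| := by
  have h := hM.abs_q2_sub_le_mul ht
  rw [← hM.lip_factor, mul_sub, mul_one]
  have := abs_sub_abs_le_abs_sub (M.q2 M.lamStar (M.tStar p)) (M.q2 M.lamStar t)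
  rw [abs_sub_comm, ← curv_eq] at this
  linarith

/-- Mean value inequality for q' minus its linearisation at tₚ*, where q' vanishes. -/
theorem abs_q1_sub_linear_le (hM : M.Nondegenerate) {p : Fin k} {t : ℝ}
    (ht : |t - M.tStar p| ≤ M.deltaZero p) :
    |M.q1 M.lamStar t - M.q2 M.lamStar (M.tStar p) * (t - M.tStar p)|
      ≤ M.curv p * (cThree * M.ell / M.radDen) * |t - M.tStar p| := by
  have hder : ∀ x ∈ Metric.closedBall (M.tStar p) (M.deltaZero p), HasDerivWithinAt
      (fun x => M.q1 M.lamStar x - M.q2 M.lamStar (M.tStar p) * (x - M.tStar p))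
      (M.q2 M.lamStar x - M.q2 M.lamStar (M.tStar p))
      (Metric.closedBall (M.tStar p) (M.deltaZero p)) x := fun x _ => by
    simpa using ((M.hasDerivAt_q1 M.lamStar x).fun_sub
      (((hasDerivAt_id x).sub_const (M.tStar p)).const_mul
        (M.q2 M.lamStar (M.tStar p)))).hasDerivWithinAt
  have h := (convex_closedBall (M.tStar p) (M.deltaZero p)).norm_image_sub_le_of_norm_hasDerivWithin_le
    hder (fun x hx => hM.abs_q2_sub_le_mul (p := p) (by simpa [Real.dist_eq] using hx))
    (Metric.mem_closedBall_self (hM.deltaZero_pos p).le)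
    (by simpa [Real.dist_eq] using ht : t ∈ Metric.closedBall (M.tStar p) (M.deltaZero p))
  simpa [hM.crit] using h

theorem le_abs_q1_lamStar (hM : M.Nondegenerate) {p : Fin k} {t : ℝ}
    (ht : |t - M.tStar p| ≤ M.deltaZero p) :
    M.curv p * ((4 + cThree * M.ell) / M.radDen) * |t - M.tStar p| ≤ |M.q1 M.lamStar t| := by
  have h := hM.abs_q1_sub_linear_le ht
  have h' := abs_sub_abs_le_abs_sub (M.q2 M.lamStar (M.tStar p) * (t - M.tStar p))
    (M.q1 M.lamStar t)
  rw [abs_sub_comm, abs_mul, ← curv_eq] at h'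
  rw [← hM.lip_factor]
  linarith

theorem deltaLamAt_eq (M : Model k m) (p : Fin k) :
    M.deltaLamAt p = M.σ * √(exp 1) * M.curv p / (2 * (√2 * √m)) * M.deltaZero p := by
  rw [deltaLamAt, sqrt_mul (by norm_num)]

theorem deltaLamAt_pos (hM : M.Nondegenerate) (p : Fin k) : 0 < M.deltaLamAt p := by
  have := hM.deltaZero_pos p
  have := hM.sqrt_m_pos
  have := hM.curv_pos p
  have := hM.σ_pos
  rw [deltaLamAt_eq]; positivity

theorem inRange_gammaStar (hM : M.Nondegenerate) (p : Fin k) : M.InRange p M.gammaStar := by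
  have := hM.deltaLamAt_pos p
  have := hM.sqrt_m_pos
  simp only [InRange, sub_self, headNorm, PiLp.zero_apply, ne_eq, OfNat.ofNat_ne_zero,
    not_false_eq_true, zero_pow, Finset.sum_const_zero, sqrt_zero, mul_zero]
  positivity

variable {p : Fin k} {γ : EuclideanSpace ℝ (Fin k ⊕ Fin k)}

theorem abs_q1_lamOf_sub_le (hM : M.Nondegenerate) (hγ : M.InRange p γ) (t : ℝ) :
    |M.q1 (M.lamOf γ) t - M.q1 M.lamStar t| ≤ M.curv p * M.deltaZero p / 8 := by
  have h3 := hM.σ_pos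
  have h1 := hM.sqrt_m_pos
  refine (Model.abs_q1_lamOf_sub_le h3 _ _).trans ?_
  calc _ ≤ √m / 4 * M.deltaLamAt p * (√2 / (√(exp 1) * M.σ)) :=
        mul_le_mul_of_nonneg_right (le_of_lt hγ) (by positivity)
    _ = _ := by
      rw [deltaLamAt_eq]
      field_simp
      ring

/-- The constant 0.6 is 1.2 · 2/4, from √e ≤ 1.2√2, δ₀ ≤ 2ℓσ/(4 + 2cℓ) and the 1/4 in `InRange`. -/
theorem abs_q2_lamOf_sub_le (hM : M.Nondegenerate) (hγ : M.InRange p γ) (t : ℝ) :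
    |M.q2 (M.lamOf γ) t - M.q2 M.lamStar t| ≤ M.curv p * (0.6 * M.ell / M.radDen) := by
  have h3 := hM.σ_pos
  have h1 := hM.sqrt_m_pos
  have h4 := hM.radDen_pos
  have h5 := hM.curv_pos p
  have h6 := hM.deltaZero_pos p
  have h7 := hM.ell_pos
  refine (Model.abs_q2_lamOf_sub_le h3 _ _).trans ?_
  calc _ ≤ √m / 4 * M.deltaLamAt p * (2 / M.σ ^ 2) :=
        mul_le_mul_of_nonneg_right (le_of_lt hγ) (by positivity)
    _ = √(exp 1) * M.curv p * M.deltaZero p / (4 * √2 * M.σ) := by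
      rw [deltaLamAt_eq]
      field_simp
    _ ≤ 1.2 * √2 * M.curv p * (2 * M.ell * M.σ / M.radDen) / (4 * √2 * M.σ) := by
      gcongr
      · exact sqrt_exp_one_le
      · exact hM.deltaZero_le p
    _ = _ := by field_simp; norm_num

theorem le_abs_q2_lamOf (hM : M.Nondegenerate) (hγ : M.InRange p γ) {t : ℝ}
    (ht : |t - M.tStar p| ≤ M.deltaZero p) :
    M.curv p * ((4 + (cThree - 0.6) * M.ell) / M.radDen) ≤ |M.q2 (M.lamOf γ) t| := by
  have h1 := hM.le_abs_q2_lamStar ht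
  have h2 := hM.abs_q2_lamOf_sub_le hγ t
  have h3 := abs_sub_abs_le_abs_sub (M.q2 M.lamStar t) (M.q2 (M.lamOf γ) t)
  rw [abs_sub_comm] at h3
  have e : M.curv p * ((4 + (cThree - 0.6) * M.ell) / M.radDen)
      = M.curv p * ((4 + cThree * M.ell) / M.radDen)
        - M.curv p * (0.6 * M.ell / M.radDen) := by ring
  rw [e]
  linarith

/-- After clearing denominators this is 12 + (c - 3)ℓ ≥ 0. It ensures that q_λ'' keeps at least 2/5
of the curvature on the interval. -/
theorem two_fifths_le (hM : M.Nondegenerate) :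
    2 / 5 ≤ (4 + (cThree - 0.6) * M.ell) / M.radDen := by
  have h := three_le_cThree
  have h' := hM.ell_pos
  rw [le_div_iff₀ hM.radDen_pos, radDen]
  nlinarith

theorem q2_lamOf_ne_zero (hM : M.Nondegenerate) (hγ : M.InRange p γ) {t : ℝ}
    (ht : |t - M.tStar p| ≤ M.deltaZero p) : M.q2 (M.lamOf γ) t ≠ 0 := by
  intro h0
  have h1 := hM.le_abs_q2_lamOf hγ ht
  have h2 := mul_le_mul_of_nonneg_left hM.two_fifths_le (hM.curv_pos p).le
  have h3 := hM.curv_pos p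
  rw [h0, abs_zero] at h1
  linarith

/-- At the two ends q_λ' differs from the linear function q''(tₚ*)(t - tₚ*), of size κδ₀ there with
κ = |q''(tₚ*)|, by at most (1/2 + 1/8)κδ₀. Hence it has opposite signs at the ends. -/
theorem exists_isCritNear (hM : M.Nondegenerate) (hγ : M.InRange p γ) :
    ∃ t, M.IsCritNear p (M.lamOf γ) t := by
  have hδ := hM.deltaZero_pos p
  have hκ := hM.curv_pos p
  have key : ∀ t, |t - M.tStar p| = M.deltaZero p →
      |M.q1 (M.lamOf γ) t - M.q2 M.lamStar (M.tStar p) * (t - M.tStar p)|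
        < M.curv p * M.deltaZero p := by
    intro t ht
    have h1 := hM.abs_q1_sub_linear_le ht.le
    have h2 := hM.abs_q1_lamOf_sub_le hγ t
    have h3 := abs_sub_le (M.q1 (M.lamOf γ) t) (M.q1 M.lamStar t)
      (M.q2 M.lamStar (M.tStar p) * (t - M.tStar p))
    have h4 : M.curv p * (cThree * M.ell / M.radDen) * M.deltaZero p
        ≤ M.curv p * (1 / 2) * M.deltaZero p := by
      exact mul_le_mul_of_nonneg_right
        (mul_le_mul_of_nonneg_left hM.factor_le_half hκ.le) hδ.le
    rw [ht] at h1
    nlinarith [mul_pos hκ hδ]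
  have hr := key (M.tStar p + M.deltaZero p) (by simp [abs_of_pos hδ])
  have hl := key (M.tStar p - M.deltaZero p) (by simp [abs_of_pos hδ])
  have hcont : Continuous (M.q1 (M.lamOf γ)) :=
    continuous_iff_continuousAt.2 fun x => (M.hasDerivAt_q1 _ x).continuousAt
  have hmem : (0 : ℝ) ∈ Set.uIcc (M.q1 (M.lamOf γ) (M.tStar p - M.deltaZero p))
      (M.q1 (M.lamOf γ) (M.tStar p + M.deltaZero p)) := by
    rw [curv_eq] at hr hl
    rw [add_sub_cancel_left, abs_lt] at hr
    rw [sub_sub_cancel_left, abs_lt] at hl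
    rw [Set.mem_uIcc]
    rcases abs_cases (M.q2 M.lamStar (M.tStar p)) with ⟨h, _⟩ | ⟨h, _⟩
    · left; rw [h] at hr hl; constructor <;> nlinarith
    · right; rw [h] at hr hl; constructor <;> nlinarith
  obtain ⟨t, ht, h0⟩ := intermediate_value_uIcc hcont.continuousOn hmem
  rw [Set.uIcc_of_le (by linarith)] at ht
  exact ⟨t, (M.isCritNear_iff _ _ _).2 ⟨abs_le.2 ⟨by linarith [ht.1], by linarith [ht.2]⟩, h0⟩⟩

/-- Rolle: two zeros of q_λ' would force a zero of q_λ'' between them. -/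
theorem isCritNear_unique (hM : M.Nondegenerate) (hγ : M.InRange p γ) {x y : ℝ}
    (hx : M.IsCritNear p (M.lamOf γ) x) (hy : M.IsCritNear p (M.lamOf γ) y) : x = y := by
  rw [isCritNear_iff] at hx hy
  wlog hxy : x ≤ y generalizing x y
  · exact (this hy hx (le_of_not_ge hxy)).symm
  by_contra hne
  obtain ⟨z, hz, h0⟩ := exists_hasDerivAt_eq_zero (lt_of_le_of_ne hxy hne)
    (fun t _ => (M.hasDerivAt_q1 (M.lamOf γ) t).continuousAt.continuousWithinAt)
    (hx.2.trans hy.2.symm) (fun t _ => M.hasDerivAt_q1 (M.lamOf γ) t)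
  have h1 := abs_le.1 hx.1
  have h2 := abs_le.1 hy.1
  exact hM.q2_lamOf_ne_zero hγ
    (abs_le.2 ⟨by linarith [h1.1, hz.1], by linarith [h2.2, hz.2]⟩) h0

theorem isCritNear_tLoc (hM : M.Nondegenerate) (hγ : M.InRange p γ) :
    M.IsCritNear p (M.lamOf γ) (M.tLoc p (M.lamOf γ)) := by
  have h := hM.exists_isCritNear hγ
  rw [tLoc, dif_pos h]
  exact h.choose_spec

theorem tLoc_eq_of_isCritNear (hM : M.Nondegenerate) (hγ : M.InRange p γ) {t : ℝ}
    (ht : M.IsCritNear p (M.lamOf γ) t) : M.tLoc p (M.lamOf γ) = t :=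
  hM.isCritNear_unique hγ (hM.isCritNear_tLoc hγ) ht

theorem tLoc_lamStar (hM : M.Nondegenerate) (p : Fin k) :
    M.tLoc p M.lamStar = M.tStar p := by
  rw [← M.lamOf_gammaStar]
  refine hM.tLoc_eq_of_isCritNear (hM.inRange_gammaStar p) ?_
  rw [M.lamOf_gammaStar, isCritNear_iff]
  exact ⟨by simpa using (hM.deltaZero_pos p).le, hM.crit p⟩

/-- The default value tₚ* also lies in the interval, so no range condition is needed. This covers
every λ_δ in the supremum defining Δ̄₂. -/
theorem abs_tLoc_sub_le_deltaZero (hM : M.Nondegenerate) (p : Fin k)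
    (lam : EuclideanSpace ℝ (Fin m)) : |M.tLoc p lam - M.tStar p| ≤ M.deltaZero p := by
  rw [tLoc]
  split_ifs with h
  · exact h.choose_spec.1
  · simpa using (hM.deltaZero_pos p).le

/-- Strictness keeps nearby values of the local implicit function inside the interval, as
`hasFDerivAt_tAt` requires. -/
theorem abs_tLoc_sub_lt (hM : M.Nondegenerate) (hγ : M.InRange p γ) :
    |M.tLoc p (M.lamOf γ) - M.tStar p| < M.deltaZero p := by
  obtain ⟨h1, h2⟩ := (M.isCritNear_iff _ _ _).1 (hM.isCritNear_tLoc hγ)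
  have h3 := hM.le_abs_q1_lamStar h1
  have h4 := hM.abs_q1_lamOf_sub_le hγ (M.tLoc p (M.lamOf γ))
  rw [h2, zero_sub, abs_neg] at h4
  have h5 : M.curv p * (1 / 2) * |M.tLoc p (M.lamOf γ) - M.tStar p| ≤
      M.curv p * ((4 + cThree * M.ell) / M.radDen) * |M.tLoc p (M.lamOf γ) - M.tStar p| := by
    refine mul_le_mul_of_nonneg_right (mul_le_mul_of_nonneg_left ?_ (hM.curv_pos p).le)
      (abs_nonneg _)
    rw [← hM.lip_factor]
    linarith [hM.factor_le_half]
  have h6 := hM.curv_pos p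
  have h7 := mul_pos h6 (hM.deltaZero_pos p)
  by_contra! hcon
  nlinarith

end Nondegenerate

end Model

/-! ### The constants C_{t*} and Δ̄₂: lower bounds and finiteness. -/

theorem cThree_pos : 0 < cThree := by linarith [three_le_cThree]

theorem sqrt_exp_one_ge : 1.6 ≤ √(exp 1) := by
  apply le_sqrt_of_sq_le
  linarith [exp_one_gt_d9]

theorem four_le_cTwo : 4 ≤ cTwo := by
  have := cThree_pos
  rw [cTwo]
  have : 0 ≤ cThree * √2 / √(exp 1) := by positivity
  linarith

namespace Model

variable {k m : ℕ} {M : Model k m}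

namespace Nondegenerate

theorem ell_den_pos (hM : M.Nondegenerate) : 0 < 4 + cThree * M.ell := by
  have := hM.ell_pos
  have := cThree_pos
  positivity

/-- The left side is the first summand of C_{t*} at p, rewritten with ℓ; the second, nonnegative
summand is dropped. -/
theorem le_Ct (hM : M.Nondegenerate) (p : Fin k) :
    √2 * √m * M.radDen / (M.σ * √(exp 1) * M.curv p * (4 + cThree * M.ell)) ≤ M.Ct := by
  have h1 := hM.σ_pos
  have h2 := hM.curv_pos p
  have h3 := hM.ell_den_pos
  have h4 := cThree_pos
  have h5 := hM.norm_lamStar_pos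
  refine le_trans ?_ (le_ciSup (Set.finite_range _).bddAbove p)
  rw [CtAt, sqrt_mul (by norm_num)]
  have e : √2 * √m * M.radDen / (M.σ * √(exp 1) * M.curv p * (4 + cThree * M.ell)) =
      2 * (√2 * √m) * (2 * M.σ + cThree * ‖M.lamStar‖) /
        (M.curv p * M.σ * √(exp 1) * (4 * M.σ + cThree * ‖M.lamStar‖)) := by
    rw [radDen, hM.norm_lamStar_eq]
    have e1 : 4 * M.σ + cThree * (M.ell * M.σ) = (4 + cThree * M.ell) * M.σ := by ring
    rw [e1]
    field_simp
    ring
  rw [e]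
  have : 0 ≤ 2 * M.σ / (4 * M.σ + cThree * ‖M.lamStar‖) := by positivity
  linarith

theorem Ct_pos (hM : M.Nondegenerate) : 0 < M.Ct := by
  refine lt_of_lt_of_le ?_ (hM.le_Ct ⟨0, hM.k_pos⟩)
  have h1 := hM.σ_pos
  have h2 := hM.curv_pos ⟨0, hM.k_pos⟩
  have h3 := hM.ell_den_pos
  have h4 := hM.radDen_pos
  have h5 := hM.sqrt_m_pos
  positivity

theorem den_le_radDen (hM : M.Nondegenerate) : 4 + cThree * M.ell ≤ M.radDen := by
  have := mul_pos cThree_pos hM.ell_pos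
  rw [radDen]; linarith

theorem le_Ct' (hM : M.Nondegenerate) (p : Fin k) :
    √2 * √m / (M.σ * √(exp 1) * M.curv p) ≤ M.Ct := by
  have h1 := hM.σ_pos
  have h2 := hM.curv_pos p
  have h3 := hM.ell_den_pos
  refine le_trans ?_ (hM.le_Ct p)
  rw [mul_div_mul_comm (√2 * √m) M.radDen]
  exact le_mul_of_one_le_right (by positivity) ((one_le_div h3).2 hM.den_le_radDen)

/-- The implicit function satisfies `|tₚ(λ) - tₚ*| ≤ √(k/m) C_{t*} ‖λ - λ*‖₂`. -/
theorem sqrt_m_mul_abs_tLoc_sub_le (hM : M.Nondegenerate) {p : Fin k}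
    {γ : EuclideanSpace ℝ (Fin k ⊕ Fin k)} (hγ : M.InRange p γ) :
    √m * |M.tLoc p (M.lamOf γ) - M.tStar p| ≤ √k * M.Ct * headNorm (γ - M.gammaStar) := by
  obtain ⟨h1, h2⟩ := (M.isCritNear_iff _ _ _).1 (hM.isCritNear_tLoc hγ)
  have h3 := hM.le_abs_q1_lamStar h1
  have h4 := Model.abs_q1_lamOf_sub_le hM.σ_pos γ (M.tLoc p (M.lamOf γ))
  rw [h2, zero_sub, abs_neg] at h4
  have h5 := h3.trans h4
  have hσ := hM.σ_pos
  have hκ := hM.curv_pos p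
  have hW := hM.ell_den_pos
  have hD := hM.radDen_pos
  have hr := headNorm_nonneg (γ - M.gammaStar)
  have h6 : |M.tLoc p (M.lamOf γ) - M.tStar p| ≤ √k * headNorm (γ - M.gammaStar) *
      (√2 / (√(exp 1) * M.σ)) / (M.curv p * ((4 + cThree * M.ell) / M.radDen)) := by
    rw [le_div_iff₀' (by positivity)]
    exact h5
  calc √m * |M.tLoc p (M.lamOf γ) - M.tStar p|
      ≤ √m * (√k * headNorm (γ - M.gammaStar) *
        (√2 / (√(exp 1) * M.σ)) / (M.curv p * ((4 + cThree * M.ell) / M.radDen))) := by gcongr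
    _ = √k * (√2 * √m * M.radDen / (M.σ * √(exp 1) * M.curv p * (4 + cThree * M.ell)))
        * headNorm (γ - M.gammaStar) := by field_simp
    _ ≤ _ := by gcongr; exact hM.le_Ct p

theorem sqrt_k_le_sqrt_m (M : Model k m) : √(k : ℝ) ≤ √(m : ℝ) :=
  sqrt_le_sqrt (by exact_mod_cast M.le_m)

theorem abs_tLoc_sub_le (hM : M.Nondegenerate) {p : Fin k}
    {γ : EuclideanSpace ℝ (Fin k ⊕ Fin k)} (hγ : M.InRange p γ) :
    |M.tLoc p (M.lamOf γ) - M.tStar p| ≤ M.Ct * headNorm (γ - M.gammaStar) := by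
  have h := hM.sqrt_m_mul_abs_tLoc_sub_le hγ
  have h' : √k * M.Ct * headNorm (γ - M.gammaStar) ≤
      √m * (M.Ct * headNorm (γ - M.gammaStar)) := by
    rw [mul_assoc]
    exact mul_le_mul_of_nonneg_right (sqrt_k_le_sqrt_m M)
      (mul_nonneg hM.Ct_pos.le (headNorm_nonneg _))
  exact le_of_mul_le_mul_left (h.trans h') hM.sqrt_m_pos

/-- The gradient of the implicit function is bounded by `C_{t*}`. -/
theorem grad_bound_le_Ct (hM : M.Nondegenerate) {p : Fin k}
    {γ : EuclideanSpace ℝ (Fin k ⊕ Fin k)} (hγ : M.InRange p γ) {t : ℝ}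
    (ht : |t - M.tStar p| ≤ M.deltaZero p) :
    √k * (√2 / (√(exp 1) * M.σ)) / |M.q2 (M.lamOf γ) t| ≤ M.Ct := by
  have h := hM.le_abs_q2_lamOf hγ ht
  have hσ := hM.σ_pos
  have hκ := hM.curv_pos p
  have hW := hM.ell_den_pos
  have hD := hM.radDen_pos
  have hl := hM.ell_pos
  have hc := three_le_cThree
  have hV : 0 < 4 + (cThree - 0.6) * M.ell := by
    have : 0 < cThree - 0.6 := by linarith
    positivity
  refine le_trans ?_ (hM.le_Ct p)
  have hs : (1.41 : ℝ) ≤ √2 := le_sqrt_of_sq_le (by norm_num)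
  calc √k * (√2 / (√(exp 1) * M.σ)) / |M.q2 (M.lamOf γ) t|
      ≤ √k * (√2 / (√(exp 1) * M.σ)) /
        (M.curv p * ((4 + (cThree - 0.6) * M.ell) / M.radDen)) := by gcongr
    _ = √2 * M.radDen / (M.σ * √(exp 1) * M.curv p) *
        (√k / (4 + (cThree - 0.6) * M.ell)) := by field_simp
    _ ≤ √2 * M.radDen / (M.σ * √(exp 1) * M.curv p) *
        (√m / (4 + cThree * M.ell)) := by
      gcongr ?_ * ?_
      rw [div_le_div_iff₀ hV hW]
      -- The factor √2 gained from 2k ≤ m pays for replacing c by c - 0.6.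
      calc √k * (4 + cThree * M.ell) ≤ √k * (√2 * (4 + (cThree - 0.6) * M.ell)) := by
            gcongr
            nlinarith
        _ = √2 * √k * (4 + (cThree - 0.6) * M.ell) := by ring
        _ ≤ _ := by gcongr; exact sqrt_two_mul_sqrt_le M
    _ = _ := by field_simp

theorem deltaLam_le (M : Model k m) (p : Fin k) : M.deltaLam ≤ M.deltaLamAt p :=
  ciInf_le (Set.finite_range _).bddBelow p

theorem deltaLam_nonneg (hM : M.Nondegenerate) : 0 ≤ M.deltaLam :=
  Real.iInf_nonneg fun p => (hM.deltaLamAt_pos p).le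

/-- The subtracted term is at most σ²κ · 2.4ℓ/(4 + 2cℓ), with κ the curvature at p, and 2.4 < 3 ≤ c,
so the denominator of Δ̄₂ stays away from 0. -/
theorem Delta2_den_ge (hM : M.Nondegenerate) {p : Fin k} {lam lamδ : EuclideanSpace ℝ (Fin m)}
    (h : ‖lam - M.lamStar‖ ≤ M.deltaLam) :
    4 * (M.σ ^ 2 * M.curv p) / M.radDen ≤
      M.σ ^ 2 * |iteratedDeriv 2 (M.q M.lamStar) (M.tLoc p lamδ)|
        - 2 * √m * ‖lam - M.lamStar‖ := by
  have hσ := hM.σ_pos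
  have hκ := hM.curv_pos p
  have hD := hM.radDen_pos
  have hl := hM.ell_pos
  have hc := three_le_cThree
  have hn := hM.sqrt_m_pos
  have hd := hM.deltaZero_pos p
  rw [iteratedDeriv_two_q]
  have h1 := hM.le_abs_q2_lamStar (hM.abs_tLoc_sub_le_deltaZero p lamδ)
  have h2 : 2 * √m * ‖lam - M.lamStar‖ ≤ M.σ ^ 2 * M.curv p * (2.4 * M.ell / M.radDen) := by
    calc 2 * √m * ‖lam - M.lamStar‖ ≤ 2 * √m * M.deltaLamAt p := by
          gcongr; exact h.trans (deltaLam_le M p)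
      _ = M.σ * √(exp 1) * M.curv p / √2 * M.deltaZero p := by
          rw [deltaLamAt_eq]; field_simp
      _ ≤ M.σ * (1.2 * √2) * M.curv p / √2 * (2 * M.ell * M.σ / M.radDen) := by
          gcongr
          · exact sqrt_exp_one_le
          · exact hM.deltaZero_le p
      _ = _ := by field_simp; norm_num
  have h3 : M.σ ^ 2 * (M.curv p * ((4 + cThree * M.ell) / M.radDen)) ≤
      M.σ ^ 2 * |M.q2 M.lamStar (M.tLoc p lamδ)| := by gcongr
  have h4 : 4 * (M.σ ^ 2 * M.curv p) / M.radDen ≤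
      M.σ ^ 2 * (M.curv p * ((4 + cThree * M.ell) / M.radDen))
        - M.σ ^ 2 * M.curv p * (2.4 * M.ell / M.radDen) := by
    have e : M.σ ^ 2 * (M.curv p * ((4 + cThree * M.ell) / M.radDen))
        - M.σ ^ 2 * M.curv p * (2.4 * M.ell / M.radDen) =
        (4 + (cThree - 2.4) * M.ell) * (M.σ ^ 2 * M.curv p) / M.radDen := by ring
    rw [e]
    gcongr
    nlinarith
  linarith

/-- The supremum of an unbounded set of reals is 0 by convention; boundedness is what makes Δ̄₂
dominate its members. -/
theorem bddAbove_Delta2 (hM : M.Nondegenerate) :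
    BddAbove {d | ∃ (p : Fin k) (lam lamδ : EuclideanSpace ℝ (Fin m)),
      (∀ j : Fin m, k ≤ j.val → lam j = M.lamStar j) ∧ ‖lam - M.lamStar‖ ≤ M.deltaLam ∧
      lamδ ∈ segment ℝ M.lamStar lam ∧ d = M.Delta2At p lam lamδ} := by
  have hσ := hM.σ_pos
  have hD := hM.radDen_pos
  have hC := hM.Ct_pos
  have hc : 0 < cTwo := by linarith [four_le_cTwo]
  have hδ := hM.deltaLam_nonneg
  let B : Fin k → ℝ := fun p =>
    (cTwo * M.Ct * √m * (‖M.lamStar‖ + M.deltaLam) + 2 * √2 / √(exp 1) * M.σ) * √k /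
      (4 * (M.σ ^ 2 * M.curv p) / M.radDen) ^ 2
  have hB : ∀ p, 0 ≤ B p := fun p => by positivity
  refine ⟨∑ p, B p, ?_⟩
  rintro d ⟨p, lam, lamδ, -, hlam, hseg, rfl⟩
  refine le_trans ?_ (Finset.single_le_sum (fun i _ => hB i) (Finset.mem_univ p))
  have hκ := hM.curv_pos p
  have hnorm : ‖lamδ‖ ≤ ‖M.lamStar‖ + M.deltaLam := by
    have h1 : lamδ ∈ Metric.closedBall M.lamStar M.deltaLam :=
      (convex_closedBall _ _).segment_subset (Metric.mem_closedBall_self hδ)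
        (mem_closedBall_iff_norm.2 hlam) hseg
    have h2 := norm_sub_norm_le lamδ M.lamStar
    have h3 := mem_closedBall_iff_norm.1 h1
    linarith
  have hden := hM.Delta2_den_ge (p := p) (lamδ := lamδ) hlam
  simp only [Delta2At, B]
  gcongr

/-- The member of the supremum at λ = λ_δ = λ*; no other member is needed later. -/
theorem le_Delta2 (hM : M.Nondegenerate) (p : Fin k) :
    (cTwo * M.Ct * √m * ‖M.lamStar‖ + 2 * √2 / √(exp 1) * M.σ) * √k /
      (M.σ ^ 2 * M.curv p) ^ 2 ≤ M.Delta2 := by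
  refine le_csSup hM.bddAbove_Delta2 ⟨p, M.lamStar, M.lamStar, fun _ _ => rfl, ?_,
    left_mem_segment _ _ _, ?_⟩
  · simpa using hM.deltaLam_nonneg
  · rw [Delta2At, hM.tLoc_lamStar, ← curv]
    simp

theorem Delta2_pos (hM : M.Nondegenerate) : 0 < M.Delta2 := by
  refine lt_of_lt_of_le ?_ (hM.le_Delta2 ⟨0, hM.k_pos⟩)
  have hσ := hM.σ_pos
  have hC := hM.Ct_pos
  have hc : 0 < cTwo := by linarith [four_le_cTwo]
  have hκ := hM.curv_pos ⟨0, hM.k_pos⟩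
  have hk := hM.one_le_sqrt_k
  positivity

theorem Pi_pos (hM : M.Nondegenerate) : 0 < M.Pi :=
  (Finset.sum_pos (fun i _ => hM.a_pos i) ⟨⟨0, hM.k_pos⟩, Finset.mem_univ _⟩).trans_le hM.sum_a_le

theorem τ_nonneg (hM : M.Nondegenerate) : 0 ≤ M.τ :=
  (abs_nonneg _).trans (hM.abs_lam_le ⟨0, hM.m_pos⟩)

theorem norm_lamStar_le (hM : M.Nondegenerate) : ‖M.lamStar‖ ≤ √m * M.τ := by
  refine le_of_sq_le_sq ?_ (mul_nonneg (sqrt_nonneg _) hM.τ_nonneg)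
  rw [mul_pow, sq_sqrt (Nat.cast_nonneg _), EuclideanSpace.norm_sq_eq]
  calc ∑ j, ‖M.lamStar j‖ ^ 2 ≤ ∑ _j : Fin m, M.τ ^ 2 :=
        Finset.sum_le_sum fun j _ => pow_le_pow_left₀ (norm_nonneg _) (hM.abs_lam_le j) 2
    _ = _ := by simp

/-! ### Lower bounds for P, and the inclusion of the δ_γ-ball in the domain of tₚ. -/

/-- The part of `P` that bounds the variation of the Jacobian. -/
theorem jacobian_terms_le_P (hM : M.Nondegenerate) :
    √2 * k * (√(2 * k) * M.Ct / (√(exp 1) * M.σ) + M.Pi * (2 * √k * M.Ct ^ 2 / M.σ ^ 2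
      + 3 * √2 * M.Delta2 / (√(exp 1) * M.σ))) ≤ M.P := by
  have hσ := hM.σ_pos
  have hC := hM.Ct_pos
  have hΔ := hM.Delta2_pos
  have hP := hM.Pi_pos
  have hτ := hM.τ_nonneg
  have hk := hM.one_le_sqrt_k
  rw [P]
  refine mul_le_mul_of_nonneg_left ?_ (by positivity)
  -- The coefficient 3√2 of Δ̄₂ is 2√2 from one summand of P plus √2 ≤ √(2k) from another.
  have h1 : √2 * M.Delta2 * M.Pi / (√(exp 1) * M.σ)
      ≤ √k * √2 * M.Delta2 * M.Pi / (√(exp 1) * M.σ) := by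
    gcongr
    exact le_mul_of_one_le_left (by positivity) hk
  have h2 : 0 ≤ 1 / M.σ ^ 2 * (4 * k * M.Ct * M.Delta2 * M.τ * M.Pi + 2 * M.Ct) +
      1 / M.σ * (4 * √k * M.Ct ^ 2 * M.Pi + 8 * k * M.Ct * M.Delta2 * M.τ * M.Pi) := by
    positivity
  rw [sqrt_mul (by norm_num) (k : ℝ)]
  rw [← sub_nonneg] at h1 ⊢
  refine (add_nonneg h1 h2).trans_eq ?_
  field_simp
  ring

/-- The part of `P` that compares `δ_γ` with `δ_λ`. -/
theorem radius_terms_le_P (hM : M.Nondegenerate) :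
    √2 * k * (M.Pi / M.σ * (4 * M.Ct ^ 2 + 8 * M.Ct * M.Delta2 * M.τ
      + 3 * √2 * M.Delta2 / √(exp 1))) ≤ M.P := by
  have hσ := hM.σ_pos
  have hC := hM.Ct_pos
  have hΔ := hM.Delta2_pos
  have hP := hM.Pi_pos
  have hτ := hM.τ_nonneg
  have hk := hM.one_le_sqrt_k
  have hk' : (1 : ℝ) ≤ k := by exact_mod_cast hM.k_pos
  rw [P]
  refine mul_le_mul_of_nonneg_left ?_ (by positivity)
  have h2 : 0 ≤ 1 / M.σ ^ 2 * (2 * √k * M.Ct ^ 2 * M.Pi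
      + 4 * k * M.Ct * M.Delta2 * M.τ * M.Pi + 2 * M.Ct) := by positivity
  refine le_add_of_nonneg_of_le h2 ?_
  rw [sqrt_mul (by norm_num) (k : ℝ)]
  calc M.Pi / M.σ * (4 * M.Ct ^ 2 + 8 * M.Ct * M.Delta2 * M.τ + 3 * √2 * M.Delta2 / √(exp 1))
      = 1 / M.σ * (0 + 4 * 1 * M.Ct ^ 2 * M.Pi + 2 * √2 * M.Delta2 * M.Pi / √(exp 1)
        + 8 * 1 * M.Ct * M.Delta2 * M.τ * M.Pi + √2 * 1 * M.Delta2 * M.Pi / √(exp 1)) := by ring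
    _ ≤ _ := by
      gcongr
      positivity

theorem P_pos (hM : M.Nondegenerate) : 0 < M.P := by
  refine lt_of_lt_of_le ?_ hM.radius_terms_le_P
  have hσ := hM.σ_pos
  have hC := hM.Ct_pos
  have hΔ := hM.Delta2_pos
  have hP := hM.Pi_pos
  have hτ := hM.τ_nonneg
  have hk' : (0 : ℝ) < k := by exact_mod_cast hM.k_pos
  positivity

/-- Insert Δ̄₂ ≥ c₂C_{t*}√m‖λ*‖/(σ²κ)², with κ the curvature at p, and τ ≥ ‖λ*‖/√m, then trade the
two quadratic terms for a mixed one by 4X² + 32N² ≥ 20XN. -/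
theorem radius_terms_ge (hM : M.Nondegenerate) (p : Fin k) :
    M.Pi * M.Ct * (20 * M.Ct * ‖M.lamStar‖ / (M.σ ^ 2 * M.curv p)
        + 3 * √2 * cTwo * √m * ‖M.lamStar‖ / (√(exp 1) * (M.σ ^ 2 * M.curv p) ^ 2)) / M.σ ≤
      M.Pi / M.σ * (4 * M.Ct ^ 2 + 8 * M.Ct * M.Delta2 * M.τ
        + 3 * √2 * M.Delta2 / √(exp 1)) := by
  have hσ := hM.σ_pos
  have hC := hM.Ct_pos
  have hΔ := hM.Delta2_pos
  have hP := hM.Pi_pos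
  have hN := hM.norm_lamStar_pos
  have hn := hM.sqrt_m_pos
  have hc := four_le_cTwo
  have hX : 0 < M.σ ^ 2 * M.curv p := by have := hM.curv_pos p; positivity
  set X := M.σ ^ 2 * M.curv p with hXdef
  set N := ‖M.lamStar‖
  have hτ : N / √m ≤ M.τ := by
    rw [div_le_iff₀' hn]; exact hM.norm_lamStar_le
  have hΔ2 : cTwo * M.Ct * √m * N / X ^ 2 ≤ M.Delta2 := by
    refine le_trans ?_ (hM.le_Delta2 p)
    rw [← hXdef]
    refine div_le_div_of_nonneg_right ?_ (by positivity)
    have h1 : 0 ≤ 2 * √2 / √(exp 1) * M.σ := by positivity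
    refine (le_mul_of_one_le_right (by positivity) hM.one_le_sqrt_k).trans ?_
    refine mul_le_mul_of_nonneg_right ?_ (sqrt_nonneg _)
    linarith
  have h1 : 32 * M.Ct ^ 2 * N ^ 2 / X ^ 2 ≤ 8 * M.Ct * M.Delta2 * M.τ := by
    calc 32 * M.Ct ^ 2 * N ^ 2 / X ^ 2 = 8 * M.Ct * (4 * M.Ct * √m * N / X ^ 2) * (N / √m) := by
          field_simp; ring
      _ ≤ 8 * M.Ct * (cTwo * M.Ct * √m * N / X ^ 2) * (N / √m) := by gcongr
      _ ≤ _ := by gcongr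
  have h2 : 20 * M.Ct ^ 2 * N / X ≤ 4 * M.Ct ^ 2 + 32 * M.Ct ^ 2 * N ^ 2 / X ^ 2 := by
    have e : 4 * M.Ct ^ 2 + 32 * M.Ct ^ 2 * N ^ 2 / X ^ 2
        = M.Ct ^ 2 * (4 * X ^ 2 + 32 * N ^ 2) / X ^ 2 := by field_simp
    have e' : 20 * M.Ct ^ 2 * N / X = M.Ct ^ 2 * (20 * N * X) / X ^ 2 := by field_simp
    rw [e, e']
    gcongr
    nlinarith [sq_nonneg (2 * X - 5 * N)]
  have h3 : 3 * √2 * (cTwo * M.Ct * √m * N / X ^ 2) / √(exp 1) ≤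
      3 * √2 * M.Delta2 / √(exp 1) := by gcongr
  calc M.Pi * M.Ct * (20 * M.Ct * N / X + 3 * √2 * cTwo * √m * N / (√(exp 1) * X ^ 2)) / M.σ
      = M.Pi / M.σ * (20 * M.Ct ^ 2 * N / X
        + 3 * √2 * (cTwo * M.Ct * √m * N / X ^ 2) / √(exp 1)) := by field_simp
    _ ≤ _ := by gcongr; linarith

/-- The left side will bound the first column of J, hence σ_min. Dividing by 2P gives δ_γ < √m/(4√k)
· δ_{λ,p}, which is the range in which tₚ is defined. -/
theorem column_bound_le (hM : M.Nondegenerate) (p : Fin k) :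
    √(2 * k) * (M.Pi * (2 / (√(exp 1) ^ 2 * (M.σ ^ 2 * M.curv p)))) <
      M.P * (√m / (2 * √k)) * M.deltaLamAt p := by
  have hσ := hM.σ_pos
  have hC := hM.Ct_pos
  have hP := hM.Pi_pos
  have hN := hM.norm_lamStar_pos
  have hn := hM.sqrt_m_pos
  have hW := hM.ell_den_pos
  have hD := hM.radDen_pos
  have hκ := hM.curv_pos p
  have hk := hM.one_le_sqrt_k
  have hE := sqrt_exp_one_ge
  have hδ := hM.deltaLamAt_pos p
  have hc := four_le_cTwo
  have hc3 := cThree_pos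
  have hX : 0 < M.σ ^ 2 * M.curv p := by positivity
  have hCge := hM.le_Ct p
  have hbase := (mul_le_mul_of_nonneg_left (hM.radius_terms_ge p)
    (by positivity : (0 : ℝ) ≤ √2 * k)).trans hM.radius_terms_le_P
  have hδeq : M.deltaLamAt p = √(exp 1) * (M.σ ^ 2 * M.curv p) ^ 2 /
      (2 * √2 * √m ^ 2 * M.σ * M.radDen) := by
    rw [deltaLamAt_eq, deltaZero_eq]; field_simp
  have hCeq : √2 * √m * M.radDen / (M.σ * √(exp 1) * M.curv p * (4 + cThree * M.ell)) =
      √2 * √m * M.σ * M.radDen / (√(exp 1) * (M.σ ^ 2 * M.curv p) * (4 + cThree * M.ell)) := by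
    field_simp
  rw [hCeq] at hCge
  set X := M.σ ^ 2 * M.curv p with hXdef
  set N := ‖M.lamStar‖ with hNdef
  set W := 4 + cThree * M.ell with hWdef
  set E := √(exp 1) with hEdef
  set C₀ := √2 * √m * M.σ * M.radDen / (E * X * W) with hC₀
  have hEpos : 0 < E := by linarith
  have hC₀pos : 0 < C₀ := by positivity
  -- C_{t*} is bounded below in two ways: by C₀, whose factor 4 + 2cℓ cancels the one in δ_λ, and by
  -- this simpler quantity inside the bracket.
  have hC₀' : √2 * √m * M.σ / (E * X) ≤ C₀ := by
    rw [hC₀, mul_div_mul_comm (√2 * √m * M.σ) M.radDen]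
    exact le_mul_of_one_le_right (by positivity) ((one_le_div hW).2 hM.den_le_radDen)
  have hk2 : (k : ℝ) = √k ^ 2 := (sq_sqrt (Nat.cast_nonneg _)).symm
  have h22 : √2 ^ 2 = 2 := sq_sqrt (by norm_num)
  have hone := hM.one_le
  -- What remains after cancellation. It splits over W = 4 + cℓ: the σ-part uses √m‖λ*‖ ≥ 1, the
  -- c-part uses √2 ≤ √m and c√2 ≤ c₂√e.
  have hfin : 4 * √2 * (M.σ * W) < √m * N * (20 * M.σ + 3 * cTwo) * E := by
    have e : M.σ * W = 4 * M.σ + cThree * N := by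
      rw [hWdef, hNdef, hM.norm_lamStar_eq]; ring
    have hs : √2 ≤ 1.42 := (sqrt_le_left (by norm_num)).2 (by norm_num)
    have hc2 : cThree * √2 ≤ cTwo * E := by
      rw [cTwo, ← hEdef, add_mul, div_mul_cancel₀ _ hEpos.ne']
      linarith
    have hm2 := hM.sqrt_two_le
    have h1 : 16 * √2 * M.σ < (√m * N) * (20 * M.σ) * E := by
      calc 16 * √2 * M.σ < 1 * (20 * M.σ) * 1.6 := by nlinarith
        _ ≤ _ := by gcongr
    have h2 : 4 * √2 * (cThree * N) ≤ √m * N * (3 * cTwo) * E := by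
      calc 4 * √2 * (cThree * N) ≤ 3 * √2 ^ 2 * (cThree * N) := by
            rw [h22]
            have : 0 < cThree * N := by positivity
            nlinarith
        _ = √2 * N * 3 * (cThree * √2) := by ring
        _ ≤ √m * N * 3 * (cTwo * E) := by gcongr
        _ = _ := by ring
    rw [e]
    linarith
  calc √(2 * k) * (M.Pi * (2 / (E ^ 2 * X)))
      = √k * M.Pi / (2 * E ^ 2 * M.σ * X * W) * (4 * √2 * (M.σ * W)) := by
        rw [sqrt_mul (by norm_num)]; field_simp; norm_num
    _ < √k * M.Pi / (2 * E ^ 2 * M.σ * X * W) * (√m * N * (20 * M.σ + 3 * cTwo) * E) := by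
        gcongr
    _ = √2 * k * (M.Pi * C₀ * (20 * (√2 * √m * M.σ / (E * X)) * N / X
          + 3 * √2 * cTwo * √m * N / (E * X ^ 2)) / M.σ) * (√m / (2 * √k)) *
          (E * X ^ 2 / (2 * √2 * √m ^ 2 * M.σ * M.radDen)) := by
        rw [hC₀, hk2]
        rw [sqrt_sq (by positivity)]
        field_simp
        ring_nf
        rw [h22]
    _ ≤ √2 * k * (M.Pi * M.Ct * (20 * M.Ct * N / X
          + 3 * √2 * cTwo * √m * N / (E * X ^ 2)) / M.σ) * (√m / (2 * √k)) *
          (E * X ^ 2 / (2 * √2 * √m ^ 2 * M.σ * M.radDen)) := by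
        gcongr
        exact hC₀'.trans hCge
    _ ≤ M.P * (√m / (2 * √k)) * M.deltaLamAt p := by
        rw [← hδeq]
        gcongr

/-- If `σ_min` is bounded as the first column of the Jacobian, then all `tₚ(λ)` are well defined for
`γ` in the ball of radius `σ_min / (2P)`. -/
theorem inRange_of_norm_le (hM : M.Nondegenerate) {s : ℝ}
    (hs : ∀ κ, (∀ i, κ ≤ M.curv i) → 0 < κ →
      s ≤ √(2 * k) * (M.Pi * (2 / (√(exp 1) ^ 2 * (M.σ ^ 2 * κ)))))
    {γ : EuclideanSpace ℝ (Fin k ⊕ Fin k)} (hγ : ‖γ - M.gammaStar‖ ≤ s / (2 * M.P)) (p : Fin k) :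
    M.InRange p γ := by
  have : Nonempty (Fin k) := ⟨p⟩
  -- The source of least curvature is the worst case on both sides: the column bound decreases and
  -- δ_{λ,p} increases with the curvature.
  obtain ⟨p₀, hp₀⟩ := Finite.exists_min M.curv
  have hκ := hM.curv_pos p₀
  have h1 := (hs _ hp₀ hκ).trans_lt (hM.column_bound_le p₀)
  have hP := hM.P_pos
  have hk : 0 < √(k : ℝ) := by linarith [hM.one_le_sqrt_k]
  have hn := hM.sqrt_m_pos
  have hσ := hM.σ_pos
  have hD := hM.radDen_pos
  have h2 : s / (2 * M.P) < √m / (4 * √k) * M.deltaLamAt p₀ := by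
    rw [div_lt_iff₀ (by positivity)]
    refine h1.trans_eq ?_
    field_simp
    ring
  have h3 : M.deltaLamAt p₀ ≤ M.deltaLamAt p := by
    rw [deltaLamAt_eq, deltaLamAt_eq, deltaZero_eq, deltaZero_eq]
    have := hp₀ p
    have := hM.curv_pos p
    gcongr
  calc √k * headNorm (γ - M.gammaStar) < √k * (√m / (4 * √k) * M.deltaLamAt p₀) := by
        gcongr; exact (headNorm_le _).trans_lt (hγ.trans_lt h2)
    _ = √m / 4 * M.deltaLamAt p₀ := by field_simp
    _ ≤ _ := by gcongr

end Nondegenerate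

end Model

/-! ### Differentiability of tₚ and of F. -/

theorem continuous_gaussianD1 (σ : ℝ) : Continuous (gaussianD1 σ) :=
  continuous_iff_continuousAt.2 fun t => (hasDerivAt_gaussianD1 σ t).continuousAt

theorem continuous_gaussianD2 (σ : ℝ) : Continuous (gaussianD2 σ) :=
  continuous_iff_continuousAt.2 fun t => (hasDerivAt_gaussianD2 σ t).continuousAt

theorem continuous_headNorm {k : ℕ} : Continuous (headNorm (k := k)) := by
  unfold headNorm; fun_prop

namespace Model

variable {k m : ℕ} (M : Model k m)

/-- The implicit function `tₚ` as a function of `γ = (λ, ν)`. -/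
def tAt (p : Fin k) (γ : EuclideanSpace ℝ (Fin k ⊕ Fin k)) : ℝ := M.tLoc p (M.lamOf γ)

/-- The derivative of `γ ↦ q_λ'(t)`. -/
def headSum (t : ℝ) : EuclideanSpace ℝ (Fin k ⊕ Fin k) →L[ℝ] ℝ :=
  ∑ l, gaussianD1 M.σ (t - M.sHead l) • EuclideanSpace.proj (Sum.inl l)

theorem headSum_apply (t : ℝ) (v : EuclideanSpace ℝ (Fin k ⊕ Fin k)) :
    M.headSum t v = ∑ l, v (Sum.inl l) * gaussianD1 M.σ (t - M.sHead l) := by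
  simp [headSum, mul_comm]

/-- The derivative of the implicit function `tₚ` at `γ`. -/
def tDeriv (p : Fin k) (γ : EuclideanSpace ℝ (Fin k ⊕ Fin k)) :
    EuclideanSpace ℝ (Fin k ⊕ Fin k) →L[ℝ] ℝ :=
  (-(M.q2 (M.lamOf γ) (M.tAt p γ))⁻¹) • M.headSum (M.tAt p γ)

theorem q1_lamOf' (γ : EuclideanSpace ℝ (Fin k ⊕ Fin k)) (t : ℝ) :
    M.q1 (M.lamOf γ) t = M.q1 M.lamStar t + M.headSum t (γ - M.gammaStar) := by
  rw [q1_lamOf, headSum_apply]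

variable {M}

namespace Nondegenerate

/-- `tLoc` is a mere choice. By uniqueness of the critical point it agrees near γ with the function
from the implicit function theorem, and so inherits its derivative. -/
theorem hasFDerivAt_tAt (hM : M.Nondegenerate) {p : Fin k}
    {γ : EuclideanSpace ℝ (Fin k ⊕ Fin k)} (hγ : M.InRange p γ) :
    HasFDerivAt (M.tAt p) (M.tDeriv p γ) γ := by
  let f : EuclideanSpace ℝ (Fin k ⊕ Fin k) → ℝ → ℝ := fun x t => M.q1 (M.lamOf x) t
  let f₁ : EuclideanSpace ℝ (Fin k ⊕ Fin k) → ℝ → EuclideanSpace ℝ (Fin k ⊕ Fin k) →L[ℝ] ℝ :=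
    fun _ t => M.headSum t
  let f₂ : EuclideanSpace ℝ (Fin k ⊕ Fin k) → ℝ → ℝ →L[ℝ] ℝ :=
    fun x t => M.q2 (M.lamOf x) t • ContinuousLinearMap.id ℝ ℝ
  let u : EuclideanSpace ℝ (Fin k ⊕ Fin k) × ℝ := (γ, M.tAt p γ)
  have df₁ : ∀ᶠ v in 𝓝 u, HasFDerivAt (f · v.2) (f₁ v.1 v.2) v.1 := by
    refine Eventually.of_forall fun v => ?_
    simp only [f, f₁, q1_lamOf']
    exact ((M.headSum v.2).hasFDerivAt.comp v.1 ((hasFDerivAt_id v.1).sub_const _)).const_add _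
  have df₂ : ∀ᶠ v in 𝓝 u, HasFDerivAt (f v.1 ·) (f₂ v.1 v.2) v.2 := by
    refine Eventually.of_forall fun v => ?_
    refine (M.hasDerivAt_q1 (M.lamOf v.1) v.2).hasFDerivAt.congr_fderiv ?_
    ext; simp [f₂]
  have cf₁ : ContinuousAt ↿f₁ u := by
    have h := continuous_gaussianD1 M.σ
    refine Continuous.continuousAt (f := fun v : EuclideanSpace ℝ (Fin k ⊕ Fin k) × ℝ =>
      M.headSum v.2) ?_
    unfold headSum
    fun_prop
  have cf₂ : ContinuousAt ↿f₂ u := by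
    have h := continuous_gaussianD2 M.σ
    refine Continuous.continuousAt (f := fun v : EuclideanSpace ℝ (Fin k ⊕ Fin k) × ℝ =>
      M.q2 (M.lamOf v.1) v.2 • ContinuousLinearMap.id ℝ ℝ) ?_
    simp only [q2_lamOf]
    unfold q2
    fun_prop
  obtain ⟨hcrit, hzero⟩ := (M.isCritNear_iff _ _ _).1 (hM.isCritNear_tLoc hγ)
  have hne : M.q2 (M.lamOf γ) (M.tAt p γ) ≠ 0 := hM.q2_lamOf_ne_zero hγ hcrit
  have hl : (f₂ u.1 u.2).comp ((M.q2 (M.lamOf γ) (M.tAt p γ))⁻¹ • ContinuousLinearMap.id ℝ ℝ)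
      = ContinuousLinearMap.id ℝ ℝ := by
    ext; simp [f₂, u, hne]
  have hr : ((M.q2 (M.lamOf γ) (M.tAt p γ))⁻¹ • ContinuousLinearMap.id ℝ ℝ).comp (f₂ u.1 u.2)
      = ContinuousLinearMap.id ℝ ℝ := by
    ext; simp [f₂, u, hne]
  have hinv : (f₂ u.1 u.2).IsInvertible := .of_inverse hl hr
  have hψ := hasStrictFDerivAt_implicitFunctionOfBivariate df₁ df₂ cf₁ cf₂ hinv
  have htend := tendsto_implicitFunctionOfBivariate df₁ df₂ cf₁ cf₂ hinv
  have happly := eventually_apply_implicitFunctionOfBivariate df₁ df₂ cf₁ cf₂ hinv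
  set ψ := implicitFunctionOfBivariate df₁ df₂ cf₁ cf₂ hinv
  rw [ContinuousLinearMap.inverse_eq hl hr] at hψ
  have hder : -((M.q2 (M.lamOf γ) (M.tAt p γ))⁻¹ • ContinuousLinearMap.id ℝ ℝ) ∘L f₁ u.1 u.2
      = M.tDeriv p γ := by
    ext v; simp [f₁, u, tDeriv]
  rw [hder] at hψ
  refine hψ.hasFDerivAt.congr_of_eventuallyEq ?_
  have hnear : ∀ᶠ x in 𝓝 γ, |ψ x - M.tStar p| < M.deltaZero p :=
    (htend.sub_const _).abs.eventually_lt_const (hM.abs_tLoc_sub_lt hγ)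
  have hopen : ∀ᶠ x in 𝓝 γ, M.InRange p x :=
    (((continuous_headNorm.comp (continuous_id.sub continuous_const)).const_mul
      (√(k : ℝ))).continuousAt (x := γ)).eventually_lt_const hγ
  filter_upwards [hnear, hopen, happly] with x hx1 hx2 hx3
  refine hM.tLoc_eq_of_isCritNear hx2 ((M.isCritNear_iff _ _ _).2 ⟨hx1.le, ?_⟩)
  exact hx3.trans hzero

end Nondegenerate

/-- The derivative of the `j`-th entry of `γ ↦ F(γ, w)`. -/
def FDerivEntry (M : Model k m) (γ : EuclideanSpace ℝ (Fin k ⊕ Fin k)) (j : Fin (2 * k)) :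
    EuclideanSpace ℝ (Fin k ⊕ Fin k) →L[ℝ] ℝ :=
  -∑ i, (γ (Sum.inr i) • (gaussianD1 M.σ (M.tAt i γ - M.sFirst j) • M.tDeriv i γ)
    + gaussianKernel M.σ (M.tAt i γ - M.sFirst j) • EuclideanSpace.proj (Sum.inr i))

theorem FDerivEntry_apply (γ v : EuclideanSpace ℝ (Fin k ⊕ Fin k)) (j : Fin (2 * k)) :
    M.FDerivEntry γ j v =
      -∑ i, (γ (Sum.inr i) * (gaussianD1 M.σ (M.tAt i γ - M.sFirst j) * M.tDeriv i γ v)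
        + gaussianKernel M.σ (M.tAt i γ - M.sFirst j) * v (Sum.inr i)) := by
  simp [FDerivEntry]

/-- The derivative of `γ ↦ F(γ, w)`. -/
def FDeriv (M : Model k m) (γ : EuclideanSpace ℝ (Fin k ⊕ Fin k)) :
    EuclideanSpace ℝ (Fin k ⊕ Fin k) →L[ℝ] EuclideanSpace ℝ (Fin (2 * k)) :=
  (EuclideanSpace.equiv (Fin (2 * k)) ℝ).symm.toContinuousLinearMap ∘L
    ContinuousLinearMap.pi (M.FDerivEntry γ)

theorem FDeriv_apply (γ v : EuclideanSpace ℝ (Fin k ⊕ Fin k)) (j : Fin (2 * k)) :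
    M.FDeriv γ v j = M.FDerivEntry γ j v := rfl

namespace Nondegenerate

theorem hasFDerivAt_F (hM : M.Nondegenerate) {γ : EuclideanSpace ℝ (Fin k ⊕ Fin k)}
    (hγ : ∀ p, M.InRange p γ) (w : EuclideanSpace ℝ (Fin (2 * k))) :
    HasFDerivAt (fun γ => M.F γ w) (M.FDeriv γ) γ := by
  rw [← hasFDerivWithinAt_univ, hasFDerivWithinAt_euclidean]
  intro j
  rw [hasFDerivWithinAt_univ]
  have hcomp : EuclideanSpace.proj j ∘L M.FDeriv γ = M.FDerivEntry γ j := by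
    ext v; rfl
  rw [hcomp]
  refine (HasFDerivAt.fun_sum fun i _ => ?_).const_sub _
  have h1 : HasFDerivAt (fun γ : EuclideanSpace ℝ (Fin k ⊕ Fin k) => γ (Sum.inr i))
      (EuclideanSpace.proj (Sum.inr i) : EuclideanSpace ℝ (Fin k ⊕ Fin k) →L[ℝ] ℝ) γ :=
    (EuclideanSpace.proj (Sum.inr i) : EuclideanSpace ℝ (Fin k ⊕ Fin k) →L[ℝ] ℝ).hasFDerivAt
  have h0 : HasFDerivAt (fun γ => M.tAt i γ - M.sFirst j) (M.tDeriv i γ) γ :=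
    (hM.hasFDerivAt_tAt (hγ i)).sub_const _
  have h2 : HasFDerivAt (fun γ => gaussianKernel M.σ (M.tAt i γ - M.sFirst j))
      (gaussianD1 M.σ (M.tAt i γ - M.sFirst j) • M.tDeriv i γ) γ :=
    HasDerivAt.comp_hasFDerivAt (h₂ := gaussianKernel M.σ) γ
      (hasDerivAt_gaussianKernel M.σ (M.tAt i γ - M.sFirst j)) h0
  exact h1.mul h2

theorem jac_eq (hM : M.Nondegenerate) : M.jac = M.FDeriv M.gammaStar :=
  (hM.hasFDerivAt_F hM.inRange_gammaStar 0).fderiv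

end Nondegenerate

end Model

/-! ### Variation of ∂tₚ and of φ'(tₚ - s)∂tₚ away from γ*. -/

/-- If all `n` entries of `x` are bounded by `b`, then `‖x‖₂ ≤ √n b`. -/
theorem norm_le_sqrt_mul_of_abs_le {n : ℕ} (x : EuclideanSpace ℝ (Fin n)) {b : ℝ} (hb : 0 ≤ b)
    (h : ∀ i, |x i| ≤ b) : ‖x‖ ≤ √n * b := by
  refine le_of_sq_le_sq ?_ (by positivity)
  rw [mul_pow, sq_sqrt (Nat.cast_nonneg _), EuclideanSpace.norm_sq_eq]
  calc ∑ j, ‖x j‖ ^ 2 ≤ ∑ _j : Fin n, b ^ 2 :=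
        Finset.sum_le_sum fun j _ => pow_le_pow_left₀ (norm_nonneg _) (h j) 2
    _ = _ := by simp

namespace Model

variable {k m : ℕ} {M : Model k m}

theorem abs_headSum_le (hσ : 0 < M.σ) (t : ℝ) (v : EuclideanSpace ℝ (Fin k ⊕ Fin k)) :
    |M.headSum t v| ≤ √k * headNorm v * (√2 / (√(exp 1) * M.σ)) := by
  rw [headSum_apply]
  exact abs_sum_mul_le _ _ fun l => abs_gaussianD1_le hσ _

theorem abs_headSum_sub_le (hσ : 0 < M.σ) (x y : ℝ) (v : EuclideanSpace ℝ (Fin k ⊕ Fin k)) :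
    |M.headSum x v - M.headSum y v| ≤ √k * headNorm v * (2 / M.σ ^ 2 * |x - y|) := by
  rw [headSum_apply, headSum_apply, ← Finset.sum_sub_distrib]
  simp only [← mul_sub]
  refine abs_sum_mul_le _ _ fun l => (abs_gaussianD1_sub_le hσ _ _).trans_eq ?_
  rw [sub_sub_sub_cancel_right]

namespace Nondegenerate

theorem tAt_gammaStar (hM : M.Nondegenerate) (p : Fin k) : M.tAt p M.gammaStar = M.tStar p := by
  rw [tAt, M.lamOf_gammaStar, hM.tLoc_lamStar]

theorem tDeriv_gammaStar (hM : M.Nondegenerate) (p : Fin k) :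
    M.tDeriv p M.gammaStar
      = (-(M.q2 M.lamStar (M.tStar p))⁻¹) • M.headSum (M.tStar p) := by
  rw [tDeriv, hM.tAt_gammaStar, M.lamOf_gammaStar]

variable {p : Fin k} {γ : EuclideanSpace ℝ (Fin k ⊕ Fin k)}

theorem abs_tDeriv_le (hM : M.Nondegenerate) (hγ : M.InRange p γ)
    (v : EuclideanSpace ℝ (Fin k ⊕ Fin k)) : |M.tDeriv p γ v| ≤ M.Ct * headNorm v := by
  have h := hM.grad_bound_le_Ct hγ (hM.isCritNear_tLoc hγ).1
  have hv := headNorm_nonneg v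
  rw [tDeriv, smul_apply, smul_eq_mul, abs_mul, abs_neg, abs_inv]
  calc |M.q2 (M.lamOf γ) (M.tAt p γ)|⁻¹ * |M.headSum (M.tAt p γ) v|
      ≤ |M.q2 (M.lamOf γ) (M.tAt p γ)|⁻¹ * (√k * headNorm v * (√2 / (√(exp 1) * M.σ))) := by
        gcongr; exact abs_headSum_le hM.σ_pos _ _
    _ = √k * (√2 / (√(exp 1) * M.σ)) / |M.q2 (M.lamOf γ) (M.tLoc p (M.lamOf γ))|
          * headNorm v := by
        rw [tAt]; ring
    _ ≤ _ := by gcongr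

theorem abs_tDeriv_gammaStar_le (hM : M.Nondegenerate)
    (v : EuclideanSpace ℝ (Fin k ⊕ Fin k)) :
    |M.tDeriv p M.gammaStar v| ≤ √k * headNorm v * (√2 / (√(exp 1) * M.σ)) / M.curv p := by
  rw [hM.tDeriv_gammaStar, smul_apply, smul_eq_mul, abs_mul, abs_neg, abs_inv,
    ← curv_eq, inv_mul_eq_div]
  have := hM.curv_pos p
  gcongr
  exact abs_headSum_le hM.σ_pos _ _

/-- The variation of the second derivative at the critical point. -/
theorem abs_q2_tAt_sub_le (hM : M.Nondegenerate) (hγ : M.InRange p γ) :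
    |M.q2 (M.lamOf γ) (M.tAt p γ) - M.q2 M.lamStar (M.tStar p)| ≤
      √k * headNorm (γ - M.gammaStar) * (2 + cThree * M.ell * M.Ct) / M.σ ^ 2 := by
  have hσ := hM.σ_pos
  have hc := cThree_pos
  have hl := hM.ell_pos
  have h1 := Model.abs_q2_lamOf_sub_le hσ γ (M.tAt p γ)
  have h2 := abs_q2_sub_le (M := M) hσ (M.tAt p γ) (M.tStar p)
  have h3 := hM.sqrt_m_mul_abs_tLoc_sub_le hγ
  have h4 := abs_sub_le (M.q2 (M.lamOf γ) (M.tAt p γ)) (M.q2 M.lamStar (M.tAt p γ))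
    (M.q2 M.lamStar (M.tStar p))
  have h5 : √m * ‖M.lamStar‖ * (cThree / M.σ ^ 3 * |M.tAt p γ - M.tStar p|) ≤
      cThree * M.ell / M.σ ^ 2 * (√k * M.Ct * headNorm (γ - M.gammaStar)) := by
    calc _ = cThree * M.ell / M.σ ^ 2 * (√m * |M.tAt p γ - M.tStar p|) := by
          rw [hM.norm_lamStar_eq]; field_simp
      _ ≤ _ := mul_le_mul_of_nonneg_left h3 (by positivity)
  refine (h4.trans (add_le_add h1 (h2.trans h5))).trans_eq ?_
  field_simp

theorem abs_tDeriv_sub_le (hM : M.Nondegenerate) (hγ : M.InRange p γ)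
    (v : EuclideanSpace ℝ (Fin k ⊕ Fin k)) :
    |M.tDeriv p γ v - M.tDeriv p M.gammaStar v| ≤ √k * headNorm v *
      (2 / M.σ ^ 2 * |M.tAt p γ - M.tStar p| / M.curv p
        + √2 / (√(exp 1) * M.σ) * (√k * headNorm (γ - M.gammaStar) *
          (2 + cThree * M.ell * M.Ct) / M.σ ^ 2) * (5 / (2 * M.curv p ^ 2))) := by
  have hσ := hM.σ_pos
  have hκ := hM.curv_pos p
  have hv := headNorm_nonneg v
  have hd := hM.abs_q2_tAt_sub_le hγ
  have hcrit := (hM.isCritNear_tLoc hγ).1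
  have hne : M.q2 (M.lamOf γ) (M.tAt p γ) ≠ 0 := hM.q2_lamOf_ne_zero hγ hcrit
  have hlow : 2 / 5 * M.curv p ≤ |M.q2 (M.lamOf γ) (M.tAt p γ)| := by
    refine le_trans ?_ (hM.le_abs_q2_lamOf hγ hcrit)
    rw [mul_comm]
    exact mul_le_mul_of_nonneg_left hM.two_fifths_le hκ.le
  rw [hM.tDeriv_gammaStar, tDeriv, smul_apply,
    smul_apply, smul_eq_mul, smul_eq_mul]
  have h1 := abs_headSum_sub_le hσ (M.tAt p γ) (M.tStar p) v
  have h2 := abs_headSum_le hσ (M.tAt p γ) v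
  have hκe := M.curv_eq p
  set D := M.q2 (M.lamOf γ) (M.tAt p γ)
  set D' := M.q2 M.lamStar (M.tStar p)
  have hD' : D' ≠ 0 := by
    rw [← abs_pos, ← hκe]; exact hκ
  -- Separates the variation of the numerator, over D' with |D'| = κ, from that of the denominator.
  -- There |D| ≥ 2κ/5 yields the constant 5/(2κ²).
  have e : -D⁻¹ * M.headSum (M.tAt p γ) v - -D'⁻¹ * M.headSum (M.tStar p) v =
      -((M.headSum (M.tAt p γ) v - M.headSum (M.tStar p) v) / D')
        + M.headSum (M.tAt p γ) v * (D - D') * (1 / (D * D')) := by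
    field_simp
    ring
  rw [e, mul_add]
  refine (abs_add_le _ _).trans (add_le_add ?_ ?_)
  · rw [abs_neg, abs_div, ← hκe, ← mul_div_assoc]
    gcongr
  · rw [abs_mul, abs_mul, ← mul_assoc, ← mul_assoc]
    have h5 : |1 / (D * D')| ≤ 5 / (2 * M.curv p ^ 2) := by
      rw [abs_div, abs_one, abs_mul, ← hκe, div_le_div_iff₀ (by positivity) (by positivity)]
      nlinarith
    have hc := cThree_pos
    have hl := hM.ell_pos
    have hC := hM.Ct_pos
    have hr := headNorm_nonneg (γ - M.gammaStar)
    gcongr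

/-- The variation of `φ'(tₚ(λ) - s) ∂tₚ(λ)`, estimated by the constants in `P`. -/
theorem abs_gaussianD1_mul_tDeriv_sub_le (hM : M.Nondegenerate) (hγ : M.InRange p γ) (s : ℝ)
    (v : EuclideanSpace ℝ (Fin k ⊕ Fin k)) :
    |gaussianD1 M.σ (M.tAt p γ - s) * M.tDeriv p γ v
        - gaussianD1 M.σ (M.tStar p - s) * M.tDeriv p M.gammaStar v| ≤
      √k * (2 * √k * M.Ct ^ 2 / M.σ ^ 2 + 3 * √2 * M.Delta2 / (√(exp 1) * M.σ))
        * (headNorm (γ - M.gammaStar) * headNorm v) := by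
  have hσ := hM.σ_pos
  have hκ := hM.curv_pos p
  have hv := headNorm_nonneg v
  have hr := headNorm_nonneg (γ - M.gammaStar)
  have hc := cThree_pos
  have hl := hM.ell_pos
  have hC := hM.Ct_pos
  have hn := hM.sqrt_m_pos
  have hX : 0 < M.σ ^ 2 * M.curv p := by positivity
  have h22 : √2 ^ 2 = 2 := sq_sqrt (by norm_num)
  have h1 := hM.abs_tDeriv_sub_le hγ v
  have h2 := hM.abs_tDeriv_gammaStar_le (p := p) v
  have h3 := abs_gaussianD1_le hσ (M.tAt p γ - s)
  have h4 := abs_gaussianD1_sub_le hσ (M.tAt p γ - s) (M.tStar p - s)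
  rw [sub_sub_sub_cancel_right] at h4
  have hd : |M.tAt p γ - M.tStar p| ≤ √k * M.Ct * headNorm (γ - M.gammaStar) / √m := by
    rw [le_div_iff₀' hn]; exact hM.sqrt_m_mul_abs_tLoc_sub_le hγ
  have hCt : √2 / (√(exp 1) * M.σ * M.curv p) ≤ M.Ct / √m := by
    rw [le_div_iff₀ hn]
    refine le_trans (le_of_eq ?_) (hM.le_Ct' p)
    ring
  have hm2 : (2 : ℝ) ≤ √m ^ 2 := by
    rw [← h22]; exact pow_le_pow_left₀ (sqrt_nonneg _) hM.sqrt_two_le 2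
  set E := √(exp 1) with hEdef
  have hEpos : 0 < E := by rw [hEdef]; positivity
  set r := headNorm (γ - M.gammaStar)
  set d := |M.tAt p γ - M.tStar p|
  have hd0 : 0 ≤ d := abs_nonneg _
  -- the terms with a first order variation of `tₚ`
  have hfirst : 4 / M.σ ^ 2 * d * (√2 / (E * M.σ * M.curv p)) ≤ 2 * √k * M.Ct ^ 2 / M.σ ^ 2 * r := by
    calc 4 / M.σ ^ 2 * d * (√2 / (E * M.σ * M.curv p))
        ≤ 4 / M.σ ^ 2 * (√k * M.Ct * r / √m) * (M.Ct / √m) := by gcongr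
      _ = 4 * √k * M.Ct ^ 2 / M.σ ^ 2 * r / √m ^ 2 := by field_simp
      _ ≤ 4 * √k * M.Ct ^ 2 / M.σ ^ 2 * r / 2 := by gcongr
      _ = _ := by ring
  -- the terms with a variation of the second derivative
  have hsecond : √2 / (E * M.σ) * (√2 / (E * M.σ)) * (√k * r * (2 + cThree * M.ell * M.Ct) / M.σ ^ 2)
      * (5 / (2 * M.curv p ^ 2)) ≤ 3 * √2 * M.Delta2 / (E * M.σ) * r := by
    -- Comparison with the numerator of Δ̄₂ at λ*: its σ-summand contributes 12 ≥ 10, and c√2 ≤ c₂√e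
    -- handles the term with C_{t*}.
    have hnum : 5 * (2 + cThree * M.ell * M.Ct) * √k ≤
        3 * √2 * E * ((cTwo * M.Ct * √m * ‖M.lamStar‖ + 2 * √2 / E * M.σ) * √k) / M.σ := by
      have hc2 : cThree * √2 ≤ cTwo * E := by
        rw [cTwo, ← hEdef, add_mul, div_mul_cancel₀ _ hEpos.ne']
        linarith
      have hell : 5 * (cThree * M.ell * M.Ct) ≤ 3 * √2 * E * (cTwo * M.Ct * √m * M.ell) := by
        calc 5 * (cThree * M.ell * M.Ct) ≤ 3 * √2 ^ 2 * (cThree * M.ell * M.Ct) := by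
              rw [h22]; gcongr; norm_num
          _ = 3 * (cThree * √2) * M.Ct * √2 * M.ell := by ring
          _ ≤ 3 * (cTwo * E) * M.Ct * √m * M.ell * √2 := by
              have h := hM.sqrt_two_le
              have hs : (1 : ℝ) ≤ √2 := one_le_sqrt.2 (by norm_num)
              have hc2' : 0 ≤ cTwo * E := le_trans (by positivity) hc2
              calc 3 * (cThree * √2) * M.Ct * √2 * M.ell
                  ≤ 3 * (cTwo * E) * M.Ct * √m * M.ell := by gcongr
                _ ≤ _ := le_mul_of_one_le_right (by positivity) hs
          _ = _ := by ring
      have e : 3 * √2 * E * ((cTwo * M.Ct * √m * ‖M.lamStar‖ + 2 * √2 / E * M.σ) * √k) / M.σ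
          = (3 * √2 * E * (cTwo * M.Ct * √m * M.ell) + 6 * √2 ^ 2) * √k := by
        rw [hM.norm_lamStar_eq]; field_simp; ring
      rw [e, h22]
      gcongr
      linarith
    calc √2 / (E * M.σ) * (√2 / (E * M.σ)) * (√k * r * (2 + cThree * M.ell * M.Ct) / M.σ ^ 2)
          * (5 / (2 * M.curv p ^ 2))
        = 5 * (2 + cThree * M.ell * M.Ct) * √k / (E ^ 2 * (M.σ ^ 2 * M.curv p) ^ 2) * r := by
          field_simp; rw [h22]; ring
      _ ≤ 3 * √2 * E * ((cTwo * M.Ct * √m * ‖M.lamStar‖ + 2 * √2 / E * M.σ) * √k) / M.σ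
          / (E ^ 2 * (M.σ ^ 2 * M.curv p) ^ 2) * r := by gcongr
      _ = 3 * √2 * ((cTwo * M.Ct * √m * ‖M.lamStar‖ + 2 * √2 / E * M.σ) * √k
          / (M.σ ^ 2 * M.curv p) ^ 2) / (E * M.σ) * r := by field_simp
      _ ≤ _ := by gcongr; exact hM.le_Delta2 p
  have e : gaussianD1 M.σ (M.tAt p γ - s) * M.tDeriv p γ v
        - gaussianD1 M.σ (M.tStar p - s) * M.tDeriv p M.gammaStar v =
      gaussianD1 M.σ (M.tAt p γ - s) * (M.tDeriv p γ v - M.tDeriv p M.gammaStar v)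
        + (gaussianD1 M.σ (M.tAt p γ - s) - gaussianD1 M.σ (M.tStar p - s))
          * M.tDeriv p M.gammaStar v := by ring
  rw [e]
  calc _ ≤ |gaussianD1 M.σ (M.tAt p γ - s)| * |M.tDeriv p γ v - M.tDeriv p M.gammaStar v|
        + |gaussianD1 M.σ (M.tAt p γ - s) - gaussianD1 M.σ (M.tStar p - s)|
          * |M.tDeriv p M.gammaStar v| := by
        rw [← abs_mul, ← abs_mul]; exact abs_add_le _ _
    _ ≤ √2 / (E * M.σ) * (√k * headNorm v *
          (2 / M.σ ^ 2 * d / M.curv p + √2 / (E * M.σ) * (√k * r *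
            (2 + cThree * M.ell * M.Ct) / M.σ ^ 2) * (5 / (2 * M.curv p ^ 2))))
        + 2 / M.σ ^ 2 * d * (√k * headNorm v * (√2 / (E * M.σ)) / M.curv p) := by gcongr
    _ = √k * headNorm v * (4 / M.σ ^ 2 * d * (√2 / (E * M.σ * M.curv p)) +
          √2 / (E * M.σ) * (√2 / (E * M.σ)) * (√k * r * (2 + cThree * M.ell * M.Ct) / M.σ ^ 2)
            * (5 / (2 * M.curv p ^ 2))) := by
        field_simp
        ring
    _ ≤ √k * headNorm v * (2 * √k * M.Ct ^ 2 / M.σ ^ 2 * r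
          + 3 * √2 * M.Delta2 / (E * M.σ) * r) := by gcongr
    _ = _ := by ring

end Nondegenerate

end Model

/-! ### The smallest singular value, and the Lipschitz bound P for the Jacobian at γ*. -/

/-- The last singular value bounds a linear map from below. -/
theorem singularValues_mul_norm_le {E F : Type*} [NormedAddCommGroup E] [InnerProductSpace ℝ E]
    [FiniteDimensional ℝ E] [NormedAddCommGroup F] [InnerProductSpace ℝ F] [FiniteDimensional ℝ F]
    (T : E →ₗ[ℝ] F) {n : ℕ} (hn : Module.finrank ℝ E = n) (v : E) :
    T.singularValues (n - 1) * ‖v‖ ≤ ‖T v‖ := by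
  rcases Nat.eq_zero_or_pos n with rfl | hpos
  · have : Subsingleton E := Module.finrank_zero_iff.1 hn
    simp [Subsingleton.elim v 0]
  have hT := T.isSymmetric_adjoint_comp_self
  refine le_of_sq_le_sq ?_ (norm_nonneg _)
  have h1 : ‖T v‖ ^ 2 = ∑ i, hT.eigenvalues hn i * (hT.eigenvectorBasis hn).repr v i ^ 2 := by
    rw [← real_inner_self_eq_norm_sq, ← LinearMap.adjoint_inner_left, ← LinearMap.comp_apply,
      ← (hT.eigenvectorBasis hn).repr.inner_map_map, PiLp.inner_apply]
    refine Finset.sum_congr rfl fun i _ => ?_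
    rw [hT.eigenvectorBasis_apply_self_apply]
    simp
    ring
  have h2 : ‖v‖ ^ 2 = ∑ i, (hT.eigenvectorBasis hn).repr v i ^ 2 := by
    rw [← (hT.eigenvectorBasis hn).repr.norm_map, EuclideanSpace.norm_sq_eq]
    simp
  rw [mul_pow, T.sq_singularValues_of_lt hn (Nat.sub_lt hpos one_pos), h1, h2, Finset.mul_sum]
  refine Finset.sum_le_sum fun i _ => mul_le_mul_of_nonneg_right ?_ (sq_nonneg _)
  exact hT.eigenvalues_antitone hn (Fin.mk_le_mk.2 (Nat.le_sub_one_of_lt i.isLt))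

namespace Model

variable {k m : ℕ} {M : Model k m}

namespace Nondegenerate

/-- The difference splits into the variation of φ(tₚ - s) against the ν-part of v, the variation of
ν against φ'∂tₚ, and the variation of φ'∂tₚ weighted by a. The first two are head–tail products and
are estimated jointly; in the third, ∑ aᵢ ≤ Π. -/
theorem abs_FDerivEntry_sub_le (hM : M.Nondegenerate)
    {γ : EuclideanSpace ℝ (Fin k ⊕ Fin k)} (hγ : ∀ p, M.InRange p γ) (j : Fin (2 * k))
    (v : EuclideanSpace ℝ (Fin k ⊕ Fin k)) :
    |M.FDerivEntry γ j v - M.FDerivEntry M.gammaStar j v| ≤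
      (√(2 * k) * M.Ct / (√(exp 1) * M.σ) + M.Pi * (√k * (2 * √k * M.Ct ^ 2 / M.σ ^ 2
        + 3 * √2 * M.Delta2 / (√(exp 1) * M.σ)))) * (‖γ - M.gammaStar‖ * ‖v‖) := by
  have hσ := hM.σ_pos
  have hC := hM.Ct_pos
  have hΔ := hM.Delta2_pos
  have hP := hM.Pi_pos
  set Z := √k * (2 * √k * M.Ct ^ 2 / M.σ ^ 2 + 3 * √2 * M.Delta2 / (√(exp 1) * M.σ)) with hZ
  have hZ0 : 0 ≤ Z := by positivity
  have hr := headNorm_nonneg (γ - M.gammaStar)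
  have hv := headNorm_nonneg v
  have e : M.FDerivEntry γ j v - M.FDerivEntry M.gammaStar j v =
      -((∑ i, v (Sum.inr i) * (gaussianKernel M.σ (M.tAt i γ - M.sFirst j)
            - gaussianKernel M.σ (M.tStar i - M.sFirst j)))
        + (∑ i, (γ - M.gammaStar) (Sum.inr i)
            * (gaussianD1 M.σ (M.tAt i γ - M.sFirst j) * M.tDeriv i γ v))
        + ∑ i, M.a i * (gaussianD1 M.σ (M.tAt i γ - M.sFirst j) * M.tDeriv i γ v
            - gaussianD1 M.σ (M.tStar i - M.sFirst j) * M.tDeriv i M.gammaStar v)) := by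
    rw [FDerivEntry_apply, FDerivEntry_apply, ← Finset.sum_add_distrib, ← Finset.sum_add_distrib,
      neg_sub_neg, ← neg_sub, ← Finset.sum_sub_distrib]
    congr 1
    refine Finset.sum_congr rfl fun i _ => ?_
    rw [hM.tAt_gammaStar]
    simp only [gammaStar, PiLp.sub_apply, Sum.elim_inr]
    ring
  have h1 := abs_sum_mul_le (fun i => v (Sum.inr i))
    (fun i => gaussianKernel M.σ (M.tAt i γ - M.sFirst j)
      - gaussianKernel M.σ (M.tStar i - M.sFirst j))
    (b := √2 / (√(exp 1) * M.σ) * (M.Ct * headNorm (γ - M.gammaStar))) fun i => by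
      refine (abs_gaussianKernel_sub_le hσ _ _).trans ?_
      rw [sub_sub_sub_cancel_right]
      gcongr
      exact hM.abs_tLoc_sub_le (hγ i)
  have h2 := abs_sum_mul_le (fun i => (γ - M.gammaStar) (Sum.inr i))
    (fun i => gaussianD1 M.σ (M.tAt i γ - M.sFirst j) * M.tDeriv i γ v)
    (b := √2 / (√(exp 1) * M.σ) * (M.Ct * headNorm v)) fun i => by
      rw [abs_mul]
      gcongr
      · exact abs_gaussianD1_le hσ _
      · exact hM.abs_tDeriv_le (hγ i) v
  have h3 : |∑ i, M.a i * (gaussianD1 M.σ (M.tAt i γ - M.sFirst j) * M.tDeriv i γ v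
      - gaussianD1 M.σ (M.tStar i - M.sFirst j) * M.tDeriv i M.gammaStar v)| ≤
      M.Pi * (Z * (headNorm (γ - M.gammaStar) * headNorm v)) := by
    refine (Finset.abs_sum_le_sum_abs _ _).trans ?_
    calc _ ≤ ∑ i, M.a i * (Z * (headNorm (γ - M.gammaStar) * headNorm v)) := by
          refine Finset.sum_le_sum fun i _ => ?_
          rw [abs_mul, abs_of_pos (hM.a_pos i)]
          exact mul_le_mul_of_nonneg_left
            (hM.abs_gaussianD1_mul_tDeriv_sub_le (hγ i) _ v) (hM.a_pos i).le
      _ ≤ _ := by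
          rw [← Finset.sum_mul]
          exact mul_le_mul_of_nonneg_right hM.sum_a_le (by positivity)
  have h4 := headNorm_mul_add_tailNorm_mul_le (γ - M.gammaStar) v
  have h5 : headNorm (γ - M.gammaStar) * headNorm v ≤ ‖γ - M.gammaStar‖ * ‖v‖ := by
    gcongr
    · exact headNorm_le _
    · exact headNorm_le _
  rw [e, abs_neg]
  refine (abs_add_three _ _ _).trans ((add_le_add (add_le_add h1 h2) h3).trans ?_)
  calc √k * tailNorm v * (√2 / (√(exp 1) * M.σ) * (M.Ct * headNorm (γ - M.gammaStar)))
        + √k * tailNorm (γ - M.gammaStar) * (√2 / (√(exp 1) * M.σ) * (M.Ct * headNorm v))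
        + M.Pi * (Z * (headNorm (γ - M.gammaStar) * headNorm v))
      = √(2 * k) * M.Ct / (√(exp 1) * M.σ) * (headNorm (γ - M.gammaStar) * tailNorm v
          + tailNorm (γ - M.gammaStar) * headNorm v)
        + M.Pi * Z * (headNorm (γ - M.gammaStar) * headNorm v) := by
        rw [sqrt_mul (by norm_num)]; ring
    _ ≤ √(2 * k) * M.Ct / (√(exp 1) * M.σ) * (‖γ - M.gammaStar‖ * ‖v‖)
        + M.Pi * Z * (‖γ - M.gammaStar‖ * ‖v‖) := by gcongr
    _ = _ := by ring

/-- The Jacobian is Lipschitz at `γ*` with the constant `P`. -/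
theorem norm_FDeriv_sub_le (hM : M.Nondegenerate)
    {γ : EuclideanSpace ℝ (Fin k ⊕ Fin k)} (hγ : ∀ p, M.InRange p γ) :
    ‖M.FDeriv γ - M.FDeriv M.gammaStar‖ ≤ M.P * ‖γ - M.gammaStar‖ := by
  have hσ := hM.σ_pos
  have hC := hM.Ct_pos
  have hΔ := hM.Delta2_pos
  have hP := hM.Pi_pos
  have hk := hM.one_le_sqrt_k
  refine ContinuousLinearMap.opNorm_le_bound _ (mul_nonneg hM.P_pos.le (norm_nonneg _)) fun v => ?_
  refine (norm_le_sqrt_mul_of_abs_le _ (by positivity)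
    fun j => hM.abs_FDerivEntry_sub_le hγ j v).trans ?_
  rw [mul_assoc M.P]
  refine le_trans ?_ (mul_le_mul_of_nonneg_right hM.jacobian_terms_le_P (by positivity))
  rw [← mul_assoc]
  refine mul_le_mul_of_nonneg_right ?_ (by positivity)
  have hk2 : (k : ℝ) = √k * √k := (mul_self_sqrt (Nat.cast_nonneg _)).symm
  have e : √((2 * k : ℕ) : ℝ) = √2 * √k := by
    push_cast; exact sqrt_mul (by norm_num) _
  calc √((2 * k : ℕ) : ℝ) * (√(2 * k) * M.Ct / (√(exp 1) * M.σ)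
        + M.Pi * (√k * (2 * √k * M.Ct ^ 2 / M.σ ^ 2 + 3 * √2 * M.Delta2 / (√(exp 1) * M.σ))))
      ≤ √2 * √k * (√k * (√(2 * k) * M.Ct / (√(exp 1) * M.σ))
        + M.Pi * (√k * (2 * √k * M.Ct ^ 2 / M.σ ^ 2
          + 3 * √2 * M.Delta2 / (√(exp 1) * M.σ)))) := by
        rw [e]
        gcongr
        exact le_mul_of_one_le_left (by positivity) hk
    _ = √2 * (√k * √k) * (√(2 * k) * M.Ct / (√(exp 1) * M.σ)
        + M.Pi * (2 * √k * M.Ct ^ 2 / M.σ ^ 2 + 3 * √2 * M.Delta2 / (√(exp 1) * M.σ))) := by ring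
    _ ≤ _ := by rw [← hk2]

theorem sigmaMin_mul_norm_le (M : Model k m) (v : EuclideanSpace ℝ (Fin k ⊕ Fin k)) :
    M.sigmaMin * ‖v‖ ≤ ‖M.jac v‖ :=
  singularValues_mul_norm_le M.jac.toLinearMap (by simp [two_mul]) v

/-- The smallest singular value is at most the norm of the first column of the Jacobian. -/
theorem sigmaMin_le (hM : M.Nondegenerate) {κ : ℝ} (hκ : ∀ i, κ ≤ M.curv i) (hpos : 0 < κ) :
    M.sigmaMin ≤ √(2 * k) * (M.Pi * (2 / (√(exp 1) ^ 2 * (M.σ ^ 2 * κ)))) := by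
  have hσ := hM.σ_pos
  have hP := hM.Pi_pos
  let l : Fin k := ⟨0, hM.k_pos⟩
  let v : EuclideanSpace ℝ (Fin k ⊕ Fin k) := EuclideanSpace.single (Sum.inl l) 1
  have hv := sigmaMin_mul_norm_le M v
  have hnorm : ‖v‖ = 1 := by simp [v]
  rw [hnorm, mul_one, hM.jac_eq] at hv
  have hcast : ((2 * k : ℕ) : ℝ) = 2 * k := by push_cast; rfl
  rw [← hcast]
  refine hv.trans (norm_le_sqrt_mul_of_abs_le _ (by positivity) fun j => ?_)
  rw [FDeriv_apply, FDerivEntry_apply, abs_neg]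
  have hin : ∀ i, v (Sum.inr i) = 0 := fun i => by simp [v]
  have hhead : ∀ t, M.headSum t v = gaussianD1 M.σ (t - M.sHead l) := fun t => by
    rw [headSum_apply, Finset.sum_eq_single l]
    · simp [v]
    · intro i _ hi; simp [v, hi]
    · simp
  calc _ ≤ ∑ i, M.a i * (2 / (√(exp 1) ^ 2 * (M.σ ^ 2 * κ))) := by
        refine (Finset.abs_sum_le_sum_abs _ _).trans (Finset.sum_le_sum fun i _ => ?_)
        have hai : M.gammaStar (Sum.inr i) = M.a i := rfl
        rw [hin, mul_zero, add_zero, hai, abs_mul, abs_of_pos (hM.a_pos i), hM.tAt_gammaStar,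
          hM.tDeriv_gammaStar, smul_apply, hhead, smul_eq_mul, abs_mul, abs_mul, abs_neg, abs_inv,
          ← curv_eq]
        refine mul_le_mul_of_nonneg_left ?_ (hM.a_pos i).le
        have hκi := hκ i
        have hκpos := hM.curv_pos i
        calc _ ≤ √2 / (√(exp 1) * M.σ) * (κ⁻¹ * (√2 / (√(exp 1) * M.σ))) := by
              gcongr
              · exact abs_gaussianD1_le hσ _
              · exact abs_gaussianD1_le hσ _
          _ = √2 ^ 2 / (√(exp 1) ^ 2 * (M.σ ^ 2 * κ)) := by field_simp
          _ = _ := by rw [sq_sqrt (by norm_num : (0 : ℝ) ≤ 2)]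
    _ ≤ _ := by
        rw [← Finset.sum_mul]
        exact mul_le_mul_of_nonneg_right hM.sum_a_le (by positivity)

/-! ### The quantitative inverse function argument. -/

theorem sigmaMin_pos (hM : M.Nondegenerate) (hJ : M.jac.IsInvertible) : 0 < M.sigmaMin := by
  refine (M.jac.toLinearMap.injective_iff_forall_lt_finrank_singularValues_pos.1 hJ.injective)
    (2 * k - 1) ?_
  have := hM.k_pos
  simp
  omega

theorem inRange (hM : M.Nondegenerate) {γ : EuclideanSpace ℝ (Fin k ⊕ Fin k)}
    (hγ : ‖γ - M.gammaStar‖ ≤ M.deltaGamma) (p : Fin k) : M.InRange p γ :=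
  hM.inRange_of_norm_le (fun _ h h' => hM.sigmaMin_le h h') hγ p

theorem F_eq (M : Model k m) (γ : EuclideanSpace ℝ (Fin k ⊕ Fin k))
    (w : EuclideanSpace ℝ (Fin (2 * k))) : M.F γ w = M.F γ 0 + w := by
  ext j
  simp only [F, PiLp.add_apply, PiLp.zero_apply]
  ring

theorem F_gammaStar (hM : M.Nondegenerate) : M.F M.gammaStar 0 = 0 := by
  ext j
  have h : ∀ i, M.tLoc i (M.lamOf M.gammaStar) = M.tStar i := hM.tAt_gammaStar
  simp only [F, h, PiLp.zero_apply]
  simp [gammaStar]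

theorem norm_FDeriv_sub_jac_le (hM : M.Nondegenerate) {γ : EuclideanSpace ℝ (Fin k ⊕ Fin k)}
    (hγ : ‖γ - M.gammaStar‖ ≤ M.deltaGamma) : ‖M.FDeriv γ - M.jac‖ ≤ M.sigmaMin / 2 := by
  rw [hM.jac_eq]
  refine (hM.norm_FDeriv_sub_le (hM.inRange hγ)).trans ?_
  have hP := hM.P_pos
  calc M.P * ‖γ - M.gammaStar‖ ≤ M.P * M.deltaGamma := mul_le_mul_of_nonneg_left hγ hP.le
    _ = M.sigmaMin / 2 := by rw [deltaGamma]; field_simp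

theorem norm_F_sub_sub_le (hM : M.Nondegenerate) {γ γ' : EuclideanSpace ℝ (Fin k ⊕ Fin k)}
    (hγ : ‖γ - M.gammaStar‖ ≤ M.deltaGamma) (hγ' : ‖γ' - M.gammaStar‖ ≤ M.deltaGamma) :
    ‖M.F γ 0 - M.F γ' 0 - M.jac (γ - γ')‖ ≤ M.sigmaMin / 2 * ‖γ - γ'‖ := by
  have h := (convex_closedBall M.gammaStar M.deltaGamma).norm_image_sub_le_of_norm_hasFDerivWithin_le'
    (f := fun γ => M.F γ 0) (f' := M.FDeriv) (φ := M.jac) (C := M.sigmaMin / 2) (x := γ') (y := γ)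
    (fun x hx => (hM.hasFDerivAt_F (hM.inRange (mem_closedBall_iff_norm.1 hx)) 0).hasFDerivWithinAt)
    (fun x hx => hM.norm_FDeriv_sub_jac_le (mem_closedBall_iff_norm.1 hx))
    (mem_closedBall_iff_norm.2 hγ') (mem_closedBall_iff_norm.2 hγ)
  exact h

/-- J expands by σ_min and the nonlinear remainder loses at most half of it. Two zeros for the same
w give uniqueness; comparison with γ* gives the error bound. -/
theorem half_sigmaMin_mul_norm_le (hM : M.Nondegenerate)
    {γ γ' : EuclideanSpace ℝ (Fin k ⊕ Fin k)}
    (hγ : ‖γ - M.gammaStar‖ ≤ M.deltaGamma) (hγ' : ‖γ' - M.gammaStar‖ ≤ M.deltaGamma) :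
    M.sigmaMin / 2 * ‖γ - γ'‖ ≤ ‖M.F γ 0 - M.F γ' 0‖ := by
  have h1 := hM.norm_F_sub_sub_le hγ hγ'
  have h2 := sigmaMin_mul_norm_le M (γ - γ')
  have h3 := norm_sub_norm_le (M.jac (γ - γ')) (M.F γ 0 - M.F γ' 0)
  rw [norm_sub_rev (M.jac (γ - γ'))] at h3
  linarith

theorem exists_F_eq_zero (hM : M.Nondegenerate) (hJ : M.jac.IsInvertible)
    {w : EuclideanSpace ℝ (Fin (2 * k))} (hw : ‖w‖ ≤ M.deltaW) :
    ∃ γ, M.F γ w = 0 ∧ ‖γ - M.gammaStar‖ ≤ M.deltaGamma := by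
  have hs := hM.sigmaMin_pos hJ
  have hP := hM.P_pos
  have hδ : 0 ≤ M.deltaGamma := by rw [deltaGamma]; positivity
  obtain ⟨J, hJeq⟩ := hJ
  -- The inverse of J has norm at most 1/σ_min, by the lower bound for J.
  let Jinv : M.jac.NonlinearRightInverse :=
    { toFun := J.symm
      nnnorm := (Real.toNNReal M.sigmaMin)⁻¹
      bound' := fun y => by
        have h := sigmaMin_mul_norm_le M (J.symm y)
        rw [← hJeq, ContinuousLinearEquiv.coe_coe, J.apply_symm_apply] at h
        rw [NNReal.coe_inv, Real.coe_toNNReal _ hs.le, inv_mul_eq_div, le_div_iff₀' hs]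
        exact h
      right_inv' := fun y => by
        rw [← hJeq, ContinuousLinearEquiv.coe_coe, J.apply_symm_apply] }
  have happrox : ApproximatesLinearOn (fun γ => M.F γ 0) M.jac
      (Metric.closedBall M.gammaStar M.deltaGamma) (Real.toNNReal (M.sigmaMin / 2)) := by
    intro x hx y hy
    rw [Real.coe_toNNReal _ (by positivity)]
    exact hM.norm_F_sub_sub_le (mem_closedBall_iff_norm.1 hx) (mem_closedBall_iff_norm.1 hy)
  have hsurj := happrox.surjOn_closedBall_of_nonlinearRightInverse Jinv hδ subset_rfl
  -- The covered radius is (σ_min - σ_min/2) · σ_min/(2P) = σ_min²/(4P), exactly δ_w.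
  have hmem : -w ∈ Metric.closedBall (M.F M.gammaStar 0)
      (((Jinv.nnnorm : ℝ)⁻¹ - (Real.toNNReal (M.sigmaMin / 2) : ℝ)) * M.deltaGamma) := by
    rw [hM.F_gammaStar, mem_closedBall_zero_iff, norm_neg, Real.coe_toNNReal _ (by positivity)]
    refine hw.trans_eq ?_
    simp only [Jinv, NNReal.coe_inv, Real.coe_toNNReal _ hs.le, inv_inv]
    rw [deltaW, deltaGamma]
    field_simp
    ring
  obtain ⟨γ, hγ, hF⟩ := hsurj hmem
  refine ⟨γ, ?_, mem_closedBall_iff_norm.1 hγ⟩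
  rw [F_eq]
  simp only at hF
  rw [hF, neg_add_cancel]

end Nondegenerate

theorem nondegenerate_of_isLocalMax (hk : 0 < k) (hσ : 0 < M.σ) (ha : ∀ i, 0 < M.a i)
    (hPi : ∑ i, M.a i ≤ M.Pi) (hτ : ∀ j, |M.lamStar j| ≤ M.τ)
    (hq_one : ∀ i, M.q M.lamStar (M.tStar i) = 1)
    (hq_max : ∀ i, IsLocalMax (M.q M.lamStar) (M.tStar i))
    (hq_curv : ∀ i, iteratedDeriv 2 (M.q M.lamStar) (M.tStar i) ≠ 0) : M.Nondegenerate where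
  k_pos := hk
  σ_pos := hσ
  a_pos := ha
  sum_a_le := hPi
  abs_lam_le := hτ
  q_one := hq_one
  crit i := (hq_max i).hasDerivAt_eq_zero (M.hasDerivAt_q _ _)
  curv_pos i := abs_pos.2 (hq_curv i)

end Model

end SuperRes

end

theorem mainTheorem3 {k m : ℕ} (hk : 0 < k) (M : SuperRes.Model k m)
    (hσ : 0 < M.σ)
    (ha : ∀ i, 0 < M.a i)
    (hPi : ∑ i, M.a i ≤ M.Pi)
    (hτ : ∀ j, |M.lamStar j| ≤ M.τ)
    (hq_one : ∀ i, M.q M.lamStar (M.tStar i) = 1)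
    (hq_max : ∀ i, IsLocalMax (M.q M.lamStar) (M.tStar i))
    (hq_curv : ∀ i, iteratedDeriv 2 (M.q M.lamStar) (M.tStar i) ≠ 0)
    (hJ : M.jac.IsInvertible) :
    (∀ γ : EuclideanSpace ℝ (Fin k ⊕ Fin k), ‖γ - M.gammaStar‖ ≤ M.deltaGamma →
      ∀ p, ∃! t, M.IsCritNear p (M.lamOf γ) t) ∧
    ∀ w : EuclideanSpace ℝ (Fin (2 * k)), ‖w‖ ≤ M.deltaW →
      ∃ γ : EuclideanSpace ℝ (Fin k ⊕ Fin k),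
        M.F γ w = 0 ∧
        ‖γ - M.gammaStar‖ ≤ M.deltaGamma ∧
        (∀ γ' : EuclideanSpace ℝ (Fin k ⊕ Fin k),
          M.F γ' w = 0 → ‖γ' - M.gammaStar‖ ≤ M.deltaGamma → γ' = γ) ∧
        ‖γ - M.gammaStar‖ ≤ 2 / M.sigmaMin * ‖w‖ := by
  have hM := SuperRes.Model.nondegenerate_of_isLocalMax hk hσ ha hPi hτ hq_one hq_max hq_curv
  have hs := hM.sigmaMin_pos hJ
  have hδ : ‖M.gammaStar - M.gammaStar‖ ≤ M.deltaGamma := by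
    have := hM.P_pos
    rw [sub_self, norm_zero, SuperRes.Model.deltaGamma]
    positivity
  refine ⟨fun γ hγ p => ?_, fun w hw => ?_⟩
  · exact ⟨_, hM.isCritNear_tLoc (hM.inRange hγ p),
      fun t ht => (hM.tLoc_eq_of_isCritNear (hM.inRange hγ p) ht).symm⟩
  · obtain ⟨γ, hF, hγ⟩ := hM.exists_F_eq_zero hJ hw
    have hF0 : M.F γ 0 = -w := by
      rw [SuperRes.Model.Nondegenerate.F_eq] at hF
      exact eq_neg_of_add_eq_zero_left hF
    refine ⟨γ, hF, hγ, fun γ' hF' hγ' => ?_, ?_⟩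
    · have h := hM.half_sigmaMin_mul_norm_le hγ' hγ
      have hF0' : M.F γ' 0 = -w := by
        rw [SuperRes.Model.Nondegenerate.F_eq] at hF'
        exact eq_neg_of_add_eq_zero_left hF'
      rw [hF0, hF0', sub_self, norm_zero] at h
      have h0 : ‖γ' - γ‖ ≤ 0 := by
        by_contra! hpos
        have := mul_pos (half_pos hs) hpos
        linarith
      exact sub_eq_zero.1 (norm_le_zero_iff.1 h0)
    · have h := hM.half_sigmaMin_mul_norm_le hγ hδ
      rw [hF0, hM.F_gammaStar, sub_zero, norm_neg] at h
      rw [div_mul_eq_mul_div, le_div_iff₀ hs]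
      linarith
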